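/- Let $n$ be a positive integer, $G$ a finite group with identity $e$, and $S$ a finite set (possibly empty) with an action of $G$. Put $[n]=\{1,\dots,n\}$. An element $(\tilde\beta,z)$ of the $S$-Dowling poset $\mathcal D_n(G,S)$ consists of pairwise disjoint non-empty subsets (blocks) $B_1,\dots,B_\ell$ of $[n]$, each with a class $\bar b_i$ of functions $b_i\colon B_i\to G$ modulo $b\sim bg$ ($g\in G$), and of a function $z\colon Z\to S$ on the zero block $Z=[n]\setminus\bigcup_i B_i$. Write $\tilde B=(B,\bar b)$. The partial order is generated by the following relations, which are its covering relations: (merge) $(\tilde\beta\cup\{\tilde A,\tilde B\},z)\prec\!\cdot\,(\tilde\beta\cup\{\tilde C\},z)$, where $C=A\cup B$ and $c=a\cup bg$ for some $g\in G$; (color) $(\tilde\beta\cup\{\tilde B\},z)\prec\!\cdot\,(\tilde\beta,z')$, where $z'$ extends $z$ to $Z\cup B$ and, for some $s\in S$, $z'(i)=b(i)\cdot s$ for all $i\in B$. Let $\hat{\mathcal D}_n(G,S)=\mathcal D_n(G,S)\cup\{\hat1\}$, where $\hat 1$ is a new element larger than all others; this is a bounded poset. Fix any total order $s_1<\dots<s_m$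 on $S$ and any total order on $G\setminus\{e\}$. Label the edges $x\prec\!\cdot\, y$ of the Hasse diagram of $\hat{\mathcal D}_n(G,S)$ as follows, comparing labels lexicographically: \[ \lambda(x,y)=\begin{cases} (0,\max(\min A,\min B)) & \text{for a merge with } c(\min A)=c(\min B),\\ (2,\min C,\alpha) & \text{for a merge with } c(\min A)\ne c(\min B),\\ (1,k) & \text{for a coloring with } z'(\min B)=s_k,\\ (1,2) & \text{if } y=\hat1, \end{cases} \] where $\alpha=c(\min B)\,c(\min A)^{-1}$, with $A$ and $B$ named so that $\min A<\min B$. Then $\lambda$ is an EL-labeling of $\hat{\mathcal D}_n(G,S)$: in every closed interval $[x,y]$ there is exactly one maximal chain whose word of labels is strictly increasing, and this word lexicographically precedes the words of all other maximal chains of $[x,y]$. In particular, $\hat{\mathcal D}_n(G,S)$ is EL-shellable, that is, it is a bounded poset that admits an EL-labeling. -/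

import Mathlib

universe u

/-! ### EL-labelings of bounded posets -/

section EL

variable {P : Type*} [PartialOrder P]

/-- `c` lists the elements of a maximal chain `x = p₀ ⋖ p₁ ⋖ ⋯ ⋖ pₖ = y` of the interval
`[x, y]`. -/
structure IsMaximalChain (x y : P) (c : List P) : Prop where
  head : c.head? = some x
  last : c.getLast? = some y
  chain : c.IsChain (· ⋖ ·)

/-- The word `λ(p₀, p₁) λ(p₁, p₂) ⋯` of a chain. An edge labeling is given as a function of two
elements, of which only the values on the pairs `x ⋖ y` are ever used. -/
def chainWord {Λ : Type*} (lab : P → P → Λ) (c : List P) : List Λ :=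
  List.zipWith lab c c.tail

/-- A chain is increasing if its word is strictly increasing. -/
def IsIncreasingChain {Λ : Type*} [PartialOrder Λ] (lab : P → P → Λ) (c : List P) : Prop :=
  (chainWord lab c).Pairwise (· < ·)

/-- `lab` is an EL-labeling of the bounded poset `P`: every closed interval `[x, y]` has a unique
increasing maximal chain, and this chain lexicographically precedes all other maximal chains of
`[x, y]`. -/
def IsELLabeling [BoundedOrder P] {Λ : Type*} [PartialOrder Λ] (lab : P → P → Λ) : Prop :=
  ∀ x y : P, x ≤ y → ∃ c : List P,
    IsMaximalChain x y c ∧ IsIncreasingChain lab c ∧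
    ∀ c' : List P, IsMaximalChain x y c' → c' ≠ c →
      ¬ IsIncreasingChain lab c' ∧
        List.Lex (· < ·) (chainWord lab c) (chainWord lab c')

end EL

/-- A bounded poset is EL-shellable if it admits an EL-labeling with values in some poset. -/
def IsELShellable (P : Type u) [PartialOrder P] [BoundedOrder P] : Prop :=
  ∃ (Λ : Type u) (_ : PartialOrder Λ) (lab : P → P → Λ), IsELLabeling lab

/-! ### Partial `G`-partitions -/

/-- A function `b : B → G` on a non-empty subset `B` of `[n]` (here `Fin n`), as a partial function
on `[n]`: the set `B` consists of the `i` with `b i ≠ none`. -/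
structure BlockColoring (n : ℕ) (G : Type*) where
  /-- the partial function -/
  toFun : Fin n → Option G
  nonempty : ∃ i, toFun i ≠ none

/-- Two functions on the same subset are equivalent if `b = b' g` for some `g : G`. -/
instance BlockColoring.setoid (n : ℕ) (G : Type*) [Group G] : Setoid (BlockColoring n G) where
  r b b' := ∃ g : G, ∀ i, b.1 i = (b'.1 i).map (· * g)
  iseqv := by
    refine ⟨fun b => ⟨1, fun i => by simp⟩, ?_, ?_⟩
    · rintro b b' ⟨g, h⟩
      refine ⟨g⁻¹, fun i => ?_⟩
      rw [h i]
      simp [Option.map_map, Function.comp_def]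
    · rintro a b c ⟨g, h⟩ ⟨k, h'⟩
      refine ⟨k * g, fun i => ?_⟩
      rw [h i, h' i]
      simp [Option.map_map, Function.comp_def, mul_assoc]

/-- A block `B` together with a projectivized `G`-coloring, that is, the equivalence class of a
function `b : B → G`. -/
def ProjBlock (n : ℕ) (G : Type*) [Group G] : Type _ :=
  Quotient (BlockColoring.setoid n G)

namespace ProjBlock

variable {n : ℕ} {G : Type*} [Group G]

/-- The class of a function `b : B → G`. -/
def mk (b : BlockColoring n G) : ProjBlock n G := Quotient.mk _ b

/-- The underlying subset `B` of `[n]`. -/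
def carrier (B : ProjBlock n G) : Finset (Fin n) :=
  Quotient.liftOn B (fun b => Finset.univ.filter fun i => (b.1 i).isSome = true) (by
    rintro b b' ⟨g, h⟩
    ext i
    simp [h i])

theorem mem_carrier_mk {b : BlockColoring n G} {i : Fin n} :
    i ∈ (mk b).carrier ↔ (b.1 i).isSome = true := by
  simp [mk, carrier]

theorem carrier_nonempty (B : ProjBlock n G) : B.carrier.Nonempty := by
  induction B using Quotient.inductionOn with
  | h b =>
    obtain ⟨i, hi⟩ := b.2
    exact ⟨i, mem_carrier_mk.2 (Option.isSome_iff_ne_none.2 hi)⟩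

/-- The singleton block `{i}`; it has a unique projectivized coloring. -/
def single (i : Fin n) : ProjBlock n G :=
  mk ⟨fun j => if j = i then some 1 else none, i, by simp⟩

theorem carrier_single (i : Fin n) : (single i : ProjBlock n G).carrier = {i} := by
  ext j
  rw [single, mem_carrier_mk, Finset.mem_singleton]
  by_cases h : j = i <;> simp [h]

theorem eq_single {B : ProjBlock n G} {i : Fin n} (h : B.carrier = {i}) : B = single i := by
  induction B using Quotient.inductionOn with
  | h b =>
    have hb : ∀ j, (b.1 j).isSome = true ↔ j = i := fun j => by
      have := mem_carrier_mk (b := b) (i := j)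
      rw [← this, ← Finset.mem_singleton, ← h]
      rfl
    obtain ⟨g, hg⟩ := Option.isSome_iff_exists.1 ((hb i).2 rfl)
    refine Quotient.sound ⟨g, fun j => ?_⟩
    by_cases hj : j = i
    · subst hj
      simp [hg]
    · have : b.1 j = none := by
        have := mt (hb j).1 hj
        simpa using this
      simp [hj, this]

/-- The smallest element of a block. -/
def min (B : ProjBlock n G) : Fin n := B.carrier.min' B.carrier_nonempty

/-- `C̃` is obtained by merging `Ã` and `B̃`: `C = A ∪ B` and `c = a ∪ b g` for some `g : G`. -/
def IsUnion (A B C : ProjBlock n G) : Prop :=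
  ∃ (a b c : BlockColoring n G) (g : G), mk a = A ∧ mk b = B ∧ mk c = C ∧
    ∀ i, c.1 i = (a.1 i).or ((b.1 i).map (· * g))

theorem IsUnion.mem_carrier {A B C : ProjBlock n G} (h : IsUnion A B C) (i : Fin n) :
    i ∈ C.carrier ↔ i ∈ A.carrier ∨ i ∈ B.carrier := by
  obtain ⟨a, b, c, g, rfl, rfl, rfl, h⟩ := h
  simp [mem_carrier_mk, h i]

end ProjBlock

/-! ### The `S`-Dowling poset -/

/-- An element `(β̃, z)` of `𝒟ₙ(G, S)`: a partial `G`-partition `β̃` of `[n]`, and a function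
`z : Z → S` on the complement `Z` of the union of the blocks, as a partial function on `[n]`. -/
@[ext] structure Dowling (n : ℕ) (G : Type*) [Group G] (S : Type*) where
  /-- the (non-zero) blocks with their projectivized colorings -/
  blocks : Finset (ProjBlock n G)
  /-- the coloring of the zero block -/
  zeroColor : Fin n → Option S
  disjoint : ∀ A ∈ blocks, ∀ B ∈ blocks, A ≠ B → Disjoint A.carrier B.carrier
  zeroColor_eq_none : ∀ i, zeroColor i = none ↔ ∃ B ∈ blocks, i ∈ B.carrier

namespace Dowling

variable {n : ℕ} {G : Type*} [Group G] {S : Type*}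

/-- (merge) `x = (β̃ ∪ {Ã, B̃}, z)` and `y = (β̃ ∪ {C̃}, z)`, with `C = A ∪ B` and `c = a ∪ b g` for
some `g : G`. -/
structure IsMerge (x y : Dowling n G S) (A B C : ProjBlock n G) : Prop where
  left_mem : A ∈ x.blocks
  right_mem : B ∈ x.blocks
  ne : A ≠ B
  union : ProjBlock.IsUnion A B C
  blocks : ∀ D, D ∈ y.blocks ↔ D = C ∨ (D ∈ x.blocks ∧ D ≠ A ∧ D ≠ B)
  zeroColor : y.zeroColor = x.zeroColor

/-- (color) `x = (β̃ ∪ {B̃}, z)` and `y = (β̃, z')`, where `z'` extends `z` to `Z ∪ B` by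
`z' i = b i • s` on `B`, for some `s : S`. -/
structure IsColor [MulAction G S] (x y : Dowling n G S) (B : ProjBlock n G) : Prop where
  mem : B ∈ x.blocks
  blocks : ∀ D, D ∈ y.blocks ↔ D ∈ x.blocks ∧ D ≠ B
  zeroColor : ∃ (b : BlockColoring n G) (s : S), ProjBlock.mk b = B ∧
    ∀ i, y.zeroColor i = (x.zeroColor i).or ((b.1 i).map (· • s))

/-- The covering relations that generate the order of `𝒟ₙ(G, S)`. -/
def Step [MulAction G S] (x y : Dowling n G S) : Prop :=
  (∃ A B C, IsMerge x y A B C) ∨ ∃ B, IsColor x y B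

theorem IsMerge.notMem {x y : Dowling n G S} {A B C : ProjBlock n G} (h : IsMerge x y A B C) :
    C ∉ x.blocks := by
  intro hC
  have h1 : C = A := by
    by_contra hne
    obtain ⟨i, hi⟩ := A.carrier_nonempty
    exact Finset.disjoint_left.1 (x.disjoint C hC A h.left_mem hne)
      ((h.union.mem_carrier i).2 (Or.inl hi)) hi
  have h2 : C = B := by
    by_contra hne
    obtain ⟨i, hi⟩ := B.carrier_nonempty
    exact Finset.disjoint_left.1 (x.disjoint C hC B h.right_mem hne)
      ((h.union.mem_carrier i).2 (Or.inr hi)) hi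
  exact h.ne (h1.symm.trans h2)

theorem Step.card [MulAction G S] {x y : Dowling n G S} (h : Step x y) :
    y.blocks.card + 1 = x.blocks.card := by
  classical
  rcases h with ⟨A, B, C, h⟩ | ⟨B, h⟩
  · have hy : y.blocks = insert C ((x.blocks.erase A).erase B) := by
      ext D
      rw [h.blocks]
      simp only [Finset.mem_insert, Finset.mem_erase]
      tauto
    have hB : B ∈ x.blocks.erase A := Finset.mem_erase.2 ⟨h.ne.symm, h.right_mem⟩
    rw [hy, Finset.card_insert_of_notMem (by simp [h.notMem]), Finset.card_erase_add_one hB,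
      Finset.card_erase_add_one h.left_mem]
  · have hy : y.blocks = x.blocks.erase B := by
      ext D
      rw [h.blocks]
      simp only [Finset.mem_erase]
      tauto
    rw [hy, Finset.card_erase_add_one h.mem]

theorem eq_or_card_lt [MulAction G S] {x y : Dowling n G S}
    (h : Relation.ReflTransGen Step x y) : x = y ∨ y.blocks.card < x.blocks.card := by
  induction h with
  | refl => exact Or.inl rfl
  | tail _ hs ih =>
    have := hs.card
    rcases ih with rfl | ih
    · right; omega
    · right; omega

/-- The order of `𝒟ₙ(G, S)` is the one generated by the covering relations. -/
instance [MulAction G S] : PartialOrder (Dowling n G S) where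
  le := Relation.ReflTransGen Step
  le_refl _ := Relation.ReflTransGen.refl
  le_trans _ _ _ := Relation.ReflTransGen.trans
  le_antisymm x y h h' := by
    rcases eq_or_card_lt h with h1 | h1
    · exact h1
    · rcases eq_or_card_lt h' with h2 | h2
      · exact h2.symm
      · omega

theorem IsMerge.symm {x y : Dowling n G S} {A B C : ProjBlock n G} (h : IsMerge x y A B C) :
    IsMerge x y B A C where
  left_mem := h.right_mem
  right_mem := h.left_mem
  ne := h.ne.symm
  union := by
    obtain ⟨a, b, c, g, ha, hb, hc, hu⟩ := h.union
    have hd := x.disjoint A h.left_mem B h.right_mem h.ne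
    refine ⟨⟨fun i => (b.1 i).map (· * g), ?_⟩, a, c, 1, ?_, ha, hc, fun i => ?_⟩
    · obtain ⟨i, hi⟩ := b.2
      exact ⟨i, by simpa using hi⟩
    · rw [← hb]
      exact Quotient.sound ⟨g, fun i => rfl⟩
    · rw [hu i]
      subst ha hb
      have hi : i ∈ _ → i ∉ _ := fun hi => Finset.disjoint_left.1 hd hi
      simp only [ProjBlock.mem_carrier_mk] at hi
      cases h1 : a.1 i <;> cases h2 : b.1 i <;> simp_all
  blocks D := by rw [h.blocks]; tauto
  zeroColor := h.zeroColor

theorem min_injOn (x : Dowling n G S) : Set.InjOn ProjBlock.min (x.blocks : Set (ProjBlock n G)) := by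
  intro A hA B hB h
  by_contra hne
  refine Finset.disjoint_left.1 (x.disjoint A hA B hB hne) (Finset.min'_mem _ A.carrier_nonempty) ?_
  change A.min ∈ _
  rw [h]
  exact Finset.min'_mem _ _

theorem card_blocks_le (x : Dowling n G S) : x.blocks.card ≤ n := by
  simpa using Finset.card_le_card_of_injOn (t := Finset.univ) ProjBlock.min (fun _ _ => by simp)
    x.min_injOn

open Classical in
/-- The bottom element: all blocks are singletons and the zero block is empty. -/
noncomputable instance : Bot (Dowling n G S) where
  bot :=
    { blocks := Finset.univ.image ProjBlock.single
      zeroColor := fun _ => none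
      disjoint := by
        simp only [Finset.mem_image, Finset.mem_univ, true_and]
        rintro _ ⟨i, rfl⟩ _ ⟨j, rfl⟩ h
        rw [ProjBlock.carrier_single, ProjBlock.carrier_single, Finset.disjoint_singleton]
        rintro rfl
        exact h rfl
      zeroColor_eq_none := fun i => by
        simp only [Finset.mem_image, Finset.mem_univ, true_and, true_iff]
        exact ⟨_, ⟨i, rfl⟩, by simp [ProjBlock.carrier_single]⟩ }

theorem exists_isColor [MulAction G S] (y : Dowling n G S) (i : Fin n) (s : S)
    (h : y.zeroColor i = some s) : ∃ x B, IsColor x y B := by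
  classical
  have hi : ∀ B ∈ y.blocks, i ∉ B.carrier := fun B hB hiB => by
    have := (y.zeroColor_eq_none i).2 ⟨B, hB, hiB⟩
    simp [h] at this
  have hn : ProjBlock.single i ∉ y.blocks := fun hB => hi _ hB (by simp [ProjBlock.carrier_single])
  refine ⟨⟨insert (ProjBlock.single i) y.blocks, Function.update y.zeroColor i none, ?_, ?_⟩,
    ProjBlock.single i, ?_, ?_, ?_⟩
  · intro A hA B hB hne
    rw [Finset.mem_insert] at hA hB
    rcases hA with rfl | hA <;> rcases hB with rfl | hB
    · exact absurd rfl hne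
    · rw [ProjBlock.carrier_single, Finset.disjoint_singleton_left]
      exact hi B hB
    · rw [ProjBlock.carrier_single, Finset.disjoint_singleton_right]
      exact hi A hA
    · exact y.disjoint A hA B hB hne
  · intro j
    by_cases hj : j = i
    · subst hj
      simp [ProjBlock.carrier_single]
    · simp [hj, ProjBlock.carrier_single, y.zeroColor_eq_none j]
  · simp
  · intro D
    simp only [Finset.mem_insert]
    constructor
    · intro hD
      exact ⟨Or.inr hD, fun h' => hn (h' ▸ hD)⟩
    · rintro ⟨h1 | h1, h2⟩
      · exact absurd h1 h2
      · exact h1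
  · refine ⟨_, s, rfl, fun j => ?_⟩
    by_cases hj : j = i
    · subst hj
      simp [h]
    · simp [hj]

theorem exists_isMerge (y : Dowling n G S) (C : ProjBlock n G) (hC : C ∈ y.blocks) (i j : Fin n)
    (hi : i ∈ C.carrier) (hj : j ∈ C.carrier) (hij : i ≠ j) :
    ∃ (x : Dowling n G S) (A B : ProjBlock n G), IsMerge x y A B C := by
  classical
  obtain ⟨c, rfl⟩ : ∃ c, ProjBlock.mk c = C := Quotient.exists_rep C
  have hi' := ProjBlock.mem_carrier_mk.1 hi
  have hj' := ProjBlock.mem_carrier_mk.1 hj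
  let a : BlockColoring n G := ⟨fun k => if k = i then c.1 k else none, i, by
    simpa [Option.isSome_iff_ne_none] using hi'⟩
  let b : BlockColoring n G := ⟨fun k => if k = i then none else c.1 k, j, by
    simpa [hij.symm, Option.isSome_iff_ne_none] using hj'⟩
  have ha : ∀ k, k ∈ (ProjBlock.mk a).carrier ↔ k = i := fun k => by
    rw [ProjBlock.mem_carrier_mk]
    by_cases hk : k = i
    · subst hk; simpa [a] using hi'
    · simp [a, hk]
  have hb : ∀ k, k ∈ (ProjBlock.mk b).carrier ↔ k ≠ i ∧ k ∈ (ProjBlock.mk c).carrier := fun k => by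
    rw [ProjBlock.mem_carrier_mk, ProjBlock.mem_carrier_mk]
    by_cases hk : k = i <;> simp [b, hk]
  have hAc : ∀ k, k ∈ (ProjBlock.mk a).carrier → k ∈ (ProjBlock.mk c).carrier := fun k hk => by
    rw [(ha k).1 hk]; exact hi
  have hBc : ∀ k, k ∈ (ProjBlock.mk b).carrier → k ∈ (ProjBlock.mk c).carrier := fun k hk =>
    ((hb k).1 hk).2
  have hAB : Disjoint (ProjBlock.mk a).carrier (ProjBlock.mk b).carrier :=
    Finset.disjoint_left.2 fun k h1 h2 => ((hb k).1 h2).1 ((ha k).1 h1)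
  have hne : ProjBlock.mk a ≠ ProjBlock.mk b := fun h => by
    have h1 := (ha i).2 rfl
    rw [h] at h1
    exact ((hb i).1 h1).1 rfl
  have hout : ∀ E : ProjBlock n G, (∀ k, k ∈ E.carrier → k ∈ (ProjBlock.mk c).carrier) →
      ∀ D ∈ y.blocks, D ≠ ProjBlock.mk c → Disjoint E.carrier D.carrier := fun E hE D hD hDc =>
    Finset.disjoint_left.2 fun k h1 h2 =>
      Finset.disjoint_left.1 (y.disjoint _ hC D hD hDc.symm) (hE k h1) h2
  have hcA : ProjBlock.mk c ≠ ProjBlock.mk a := fun h => by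
    rw [h] at hj
    exact hij ((ha j).1 hj).symm
  have hcB : ProjBlock.mk c ≠ ProjBlock.mk b := fun h => by
    rw [h] at hi
    exact ((hb i).1 hi).1 rfl
  refine ⟨⟨insert (ProjBlock.mk a) (insert (ProjBlock.mk b) (y.blocks.erase (ProjBlock.mk c))),
    y.zeroColor, ?_, ?_⟩, ProjBlock.mk a, ProjBlock.mk b, ?_, ?_, hne, ?_, ?_, rfl⟩
  · intro D hD E hE h
    simp only [Finset.mem_insert, Finset.mem_erase] at hD hE
    rcases hD with rfl | rfl | ⟨hD1, hD⟩ <;> rcases hE with rfl | rfl | ⟨hE1, hE⟩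
    · exact absurd rfl h
    · exact hAB
    · exact hout _ hAc E hE hE1
    · exact hAB.symm
    · exact absurd rfl h
    · exact hout _ hBc E hE hE1
    · exact (hout _ hAc D hD hD1).symm
    · exact (hout _ hBc D hD hD1).symm
    · exact y.disjoint D hD E hE h
  · intro k
    rw [y.zeroColor_eq_none k]
    constructor
    · rintro ⟨D, hD, hk⟩
      by_cases hDc : D = ProjBlock.mk c
      · subst hDc
        by_cases hki : k = i
        · exact ⟨ProjBlock.mk a, by simp, (ha k).2 hki⟩
        · exact ⟨ProjBlock.mk b, by simp, (hb k).2 ⟨hki, hk⟩⟩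
      · exact ⟨D, by simp [hD, hDc], hk⟩
    · rintro ⟨D, hD, hk⟩
      simp only [Finset.mem_insert, Finset.mem_erase] at hD
      rcases hD with rfl | rfl | ⟨-, hD⟩
      · exact ⟨_, hC, hAc k hk⟩
      · exact ⟨_, hC, hBc k hk⟩
      · exact ⟨D, hD, hk⟩
  · simp
  · simp
  · refine ⟨a, b, c, 1, rfl, rfl, rfl, fun k => ?_⟩
    by_cases hk : k = i <;> simp [a, b, hk]
  · intro D
    have key : ∀ E : ProjBlock n G, (∀ k, k ∈ E.carrier → k ∈ (ProjBlock.mk c).carrier) →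
        ProjBlock.mk c ≠ E → E ∉ y.blocks := fun E hE hcE hEy => by
      obtain ⟨k, hk⟩ := E.carrier_nonempty
      exact Finset.disjoint_left.1 (hout E hE E hEy hcE.symm) hk hk
    simp only [Finset.mem_insert, Finset.mem_erase]
    constructor
    · intro hD
      by_cases hDc : D = ProjBlock.mk c
      · exact Or.inl hDc
      · refine Or.inr ⟨Or.inr (Or.inr ⟨hDc, hD⟩), ?_, ?_⟩
        · rintro rfl; exact key _ hAc hcA hD
        · rintro rfl; exact key _ hBc hcB hD
    · rintro (rfl | ⟨h1 | h1 | h1, h2, h3⟩)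
      · exact hC
      · exact absurd h1 h2
      · exact absurd h1 h3
      · exact h1.2

theorem exists_step_or_eq_bot [MulAction G S] (y : Dowling n G S) : (∃ x, Step x y) ∨ y = ⊥ := by
  classical
  by_cases h1 : ∃ i s, y.zeroColor i = some s
  · obtain ⟨i, s, h⟩ := h1
    obtain ⟨x, B, h⟩ := exists_isColor y i s h
    exact Or.inl ⟨x, Or.inr ⟨B, h⟩⟩
  by_cases h2 : ∃ C ∈ y.blocks, ∃ i ∈ C.carrier, ∃ j ∈ C.carrier, i ≠ j
  · obtain ⟨C, hC, i, hi, j, hj, hij⟩ := h2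
    obtain ⟨x, A, B, h⟩ := exists_isMerge y C hC i j hi hj hij
    exact Or.inl ⟨x, Or.inl ⟨A, B, C, h⟩⟩
  right
  push Not at h1 h2
  have hz : ∀ i, y.zeroColor i = none := fun i => Option.eq_none_iff_forall_ne_some.2 (h1 i)
  have hs : ∀ B ∈ y.blocks, ∀ i ∈ B.carrier, B = ProjBlock.single i := fun B hB i hi =>
    ProjBlock.eq_single (Finset.eq_singleton_iff_unique_mem.2 ⟨hi, fun j hj => h2 B hB j hj i hi⟩)
  refine Dowling.ext ?_ (funext hz)
  ext B
  change B ∈ y.blocks ↔ B ∈ Finset.univ.image ProjBlock.single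
  simp only [Finset.mem_image, Finset.mem_univ, true_and]
  constructor
  · intro hB
    obtain ⟨i, hi⟩ := B.carrier_nonempty
    exact ⟨i, (hs B hB i hi).symm⟩
  · rintro ⟨i, rfl⟩
    obtain ⟨B, hB, hi⟩ := (y.zeroColor_eq_none i).1 (hz i)
    rw [← hs B hB i hi]
    exact hB

noncomputable instance [MulAction G S] : OrderBot (Dowling n G S) where
  bot_le y := by
    induction hk : n - y.blocks.card generalizing y with
    | zero =>
      rcases exists_step_or_eq_bot y with ⟨x, h⟩ | rfl
      · have := h.card
        have := x.card_blocks_le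
        omega
      · exact le_rfl
    | succ k ih =>
      rcases exists_step_or_eq_bot y with ⟨x, h⟩ | rfl
      · have := h.card
        exact (ih x (by omega)).trans (Relation.ReflTransGen.single h)
      · exact le_rfl

/-! ### The edge labeling -/

/-- The poset of labels, with the lexicographic order: `(0, j)` and `(1, k)` are `(0, j, ⊥)` and
`(1, k, ⊥)`, and `(2, j, α)` has a last entry `α ∈ G ∖ {e}`. -/
abbrev Label (G : Type*) [Group G] : Type _ :=
  ℕ ×ₗ ℕ ×ₗ WithBot {g : G // g ≠ 1}

/-- The label with entries `i`, `j`, `α`. -/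
def Label.mk (i j : ℕ) (α : WithBot {g : G // g ≠ 1}) : Label G :=
  toLex (i, toLex (j, α))

/-- The label of an edge `x ⋖ y` of `𝒟ₙ(G, S)`:
* `(0, max (min A) (min B))` for a coherent merge, that is, if `c (min A) = c (min B)`;
* `(2, min C, c (min B) * c (min A)⁻¹)` for a non-coherent merge, where `A` and `B` are named such
  that `min A < min B`;
* `(1, k)` if the edge is colored and its color `z' (min B)` is the `k`-th smallest element of `S`.
-/
inductive HasLabel [MulAction G S] [LinearOrder S] (x y : Dowling n G S) : Label G → Prop
  | coherent (A B : ProjBlock n G) (c : BlockColoring n G)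
      (h : IsMerge x y A B (ProjBlock.mk c)) (hc : c.1 A.min = c.1 B.min) :
      HasLabel x y (Label.mk 0 (max A.min B.min : Fin n) ⊥)
  | nonCoherent (A B : ProjBlock n G) (c : BlockColoring n G)
      (h : IsMerge x y A B (ProjBlock.mk c)) (hlt : A.min < B.min) (g g' : G)
      (hA : c.1 A.min = some g) (hB : c.1 B.min = some g') (hne : g' * g⁻¹ ≠ 1) :
      HasLabel x y (Label.mk 2 (ProjBlock.mk c).min (WithBot.some ⟨g' * g⁻¹, hne⟩))
  | colored (B : ProjBlock n G) (s : S) (h : IsColor x y B) (hs : y.zeroColor B.min = some s) :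
      HasLabel x y (Label.mk 1 (Set.Iic s).ncard ⊥)

theorem IsMerge.not_isColor [MulAction G S] {x y : Dowling n G S} {A B C D : ProjBlock n G}
    (h : IsMerge x y A B C) : ¬ IsColor x y D := fun h' =>
  h.notMem ((h'.blocks C).1 ((h.blocks C).2 (Or.inl rfl))).1

theorem IsMerge.notMem_iff {x y : Dowling n G S} {A B C : ProjBlock n G}
    (h : IsMerge x y A B C) (D : ProjBlock n G) :
    D ∈ x.blocks ∧ D ∉ y.blocks ↔ D = A ∨ D = B := by
  rw [h.blocks]
  constructor
  · rintro ⟨h1, h2⟩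
    by_contra! h3
    exact h2 (Or.inr ⟨h1, h3⟩)
  · rintro (rfl | rfl)
    · refine ⟨h.left_mem, ?_⟩
      rintro (h1 | h1)
      · exact h.notMem (h1 ▸ h.left_mem)
      · exact h1.2.1 rfl
    · refine ⟨h.right_mem, ?_⟩
      rintro (h1 | h1)
      · exact h.notMem (h1 ▸ h.right_mem)
      · exact h1.2.2 rfl

theorem IsMerge.unique {x y : Dowling n G S} {A B C A' B' C' : ProjBlock n G}
    (h : IsMerge x y A B C) (h' : IsMerge x y A' B' C') :
    C = C' ∧ (A = A' ∧ B = B' ∨ A = B' ∧ B = A') := by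
  constructor
  · rcases (h'.blocks C).1 ((h.blocks C).2 (Or.inl rfl)) with h1 | h1
    · exact h1
    · exact absurd h1.1 h.notMem
  · have hA := (h'.notMem_iff A).1 ((h.notMem_iff A).2 (Or.inl rfl))
    have hB := (h'.notMem_iff B).1 ((h.notMem_iff B).2 (Or.inr rfl))
    have hne := h.ne
    rcases hA with rfl | rfl <;> rcases hB with rfl | rfl <;> simp_all

theorem IsColor.unique [MulAction G S] {x y : Dowling n G S} {B B' : ProjBlock n G}
    (h : IsColor x y B) (h' : IsColor x y B') : B = B' := by
  by_contra hne
  exact ((h.blocks B).1 ((h'.blocks B).2 ⟨h.mem, hne⟩)).2 rfl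

/-- An edge has at most one label. -/
theorem HasLabel.unique [MulAction G S] [LinearOrder S] {x y : Dowling n G S} {l l' : Label G}
    (h : HasLabel x y l) (h' : HasLabel x y l') : l = l' := by
  have key : ∀ {c d : BlockColoring n G}, ProjBlock.mk c = ProjBlock.mk d →
      ∃ g : G, ∀ i, c.1 i = (d.1 i).map (· * g) := fun h => Quotient.exact h
  rcases h with ⟨A, B, c, h, hc⟩ | ⟨A, B, c, h, hlt, g, k, hA, hB, hne⟩ | ⟨B, s, h, hs⟩ <;>
  rcases h' with ⟨A', B', c', h', hc'⟩ | ⟨A', B', c', h', hlt', g', k', hA', hB', hne'⟩ |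
    ⟨B', s', h', hs'⟩
  · rcases (h.unique h').2 with ⟨rfl, rfl⟩ | ⟨rfl, rfl⟩
    · rfl
    · rw [max_comm]
  · exfalso
    obtain ⟨u, hu⟩ := key (h.unique h').1
    rcases (h.unique h').2 with ⟨rfl, rfl⟩ | ⟨rfl, rfl⟩ <;>
    · rw [hu, hu, hA', hB'] at hc
      simp at hc
      simp [hc] at hne'
  · exact absurd h' h.not_isColor
  · exfalso
    obtain ⟨u, hu⟩ := key (h'.unique h).1
    rcases (h'.unique h).2 with ⟨rfl, rfl⟩ | ⟨rfl, rfl⟩ <;>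
    · rw [hu, hu, hA, hB] at hc'
      simp at hc'
      simp [hc'] at hne
  · have hC := (h.unique h').1
    obtain ⟨u, hu⟩ := key hC
    rcases (h.unique h').2 with ⟨rfl, rfl⟩ | ⟨rfl, rfl⟩
    · have h1 : g = g' * u := by
        have := hu A.min
        rw [hA, hA'] at this
        simpa using this
      have h2 : k = k' * u := by
        have := hu B.min
        rw [hB, hB'] at this
        simpa using this
      subst h1 h2
      rw [hC]
      simp
    · exact absurd hlt hlt'.asymm
  · exact absurd h' h.not_isColor
  · exact absurd h h'.not_isColor
  · exact absurd h h'.not_isColor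
  · obtain rfl := h.unique h'
    rw [hs] at hs'
    obtain rfl := Option.some.inj hs'
    rfl

/-- The edges of the Hasse diagram are exactly the generating covering relations. -/
theorem covBy_iff_step [MulAction G S] {x y : Dowling n G S} : x ⋖ y ↔ Step x y := by
  have hlt : ∀ {a b : Dowling n G S}, a < b → b.blocks.card < a.blocks.card := fun {a b} h =>
    (eq_or_card_lt (show Relation.ReflTransGen Step a b from h.le)).resolve_left h.ne
  constructor
  · intro h
    rcases Relation.ReflTransGen.cases_head (show Relation.ReflTransGen Step x y from h.le) with
      h1 | ⟨w, hxw, hwy⟩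
    · exact absurd h1 h.ne
    · have h1 : x ≤ w := Relation.ReflTransGen.single hxw
      have h2 : x ≠ w := by
        rintro rfl
        have := hxw.card
        omega
      rcases h.eq_or_eq h1 hwy with h3 | h3
      · exact absurd h3.symm h2
      · exact h3 ▸ hxw
  · intro h
    have hc := h.card
    have hle : x ≤ y := Relation.ReflTransGen.single h
    refine ⟨lt_of_le_of_ne hle (by rintro rfl; omega), fun w h1 h2 => ?_⟩
    have := hlt h1
    have := hlt h2
    omega

/-- Every edge of `𝒟ₙ(G, S)` has a label. -/
theorem exists_hasLabel [MulAction G S] [LinearOrder S] {x y : Dowling n G S} (h : x ⋖ y) :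
    ∃ l, HasLabel x y l := by
  rcases covBy_iff_step.1 h with ⟨A, B, C, h⟩ | ⟨B, h⟩
  · wlog hlt : A.min < B.min generalizing A B
    · exact this B A h.symm (lt_of_le_of_ne (not_lt.1 hlt) fun he =>
        h.ne (x.min_injOn h.left_mem h.right_mem he.symm))
    obtain ⟨c, rfl⟩ : ∃ c, ProjBlock.mk c = C := Quotient.exists_rep C
    obtain ⟨g, hg⟩ := Option.isSome_iff_exists.1 (ProjBlock.mem_carrier_mk.1
      ((h.union.mem_carrier A.min).2 (Or.inl (Finset.min'_mem _ _))))
    obtain ⟨g', hg'⟩ := Option.isSome_iff_exists.1 (ProjBlock.mem_carrier_mk.1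
      ((h.union.mem_carrier B.min).2 (Or.inr (Finset.min'_mem _ _))))
    by_cases hne : g' * g⁻¹ = 1
    · exact ⟨_, .coherent A B c h (by rw [hg, hg', mul_inv_eq_one.1 hne])⟩
    · exact ⟨_, .nonCoherent A B c h hlt g g' hg hg' hne⟩
  · cases hs : y.zeroColor B.min with
    | some s => exact ⟨_, .colored B s h hs⟩
    | none =>
      obtain ⟨b, s, rfl, hz⟩ := h.zeroColor
      have := hz (ProjBlock.mk b).min
      obtain ⟨g, hg⟩ := Option.isSome_iff_exists.1 (ProjBlock.mem_carrier_mk.1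
        (Finset.min'_mem _ (ProjBlock.mk b).carrier_nonempty))
      rw [hs] at this
      change b.1 (ProjBlock.mk b).min = _ at hg
      simp [hg] at this

open Classical in
/-- The label of an edge `x ⋖ y` of `𝒟ₙ(G, S)`, with the value `(1, 2)` for other pairs. -/
noncomputable def edgeLabel [MulAction G S] [LinearOrder S] (x y : Dowling n G S) : Label G :=
  if h : ∃ l, HasLabel x y l then h.choose else Label.mk 1 2 ⊥

theorem hasLabel_edgeLabel [MulAction G S] [LinearOrder S] {x y : Dowling n G S} (h : x ⋖ y) :
    HasLabel x y (edgeLabel x y) := by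
  rw [edgeLabel, dif_pos (exists_hasLabel h)]
  exact (exists_hasLabel h).choose_spec

/-- The edge labeling of `𝒟ₙ(G, S) ∪ {⊤}`; the edges `x ⋖ ⊤` have the label `(1, 2)`. -/
noncomputable def label [MulAction G S] [LinearOrder S] :
    WithTop (Dowling n G S) → WithTop (Dowling n G S) → Label G
  | (x : Dowling n G S), (y : Dowling n G S) => edgeLabel x y
  | _, _ => Label.mk 1 2 ⊥

end Dowling

/-! The comparison of whole chains reduces to a condition on chains of length at most two. In each
nontrivial interval $[x,y]$ one looks for a cover $z$ of $x$ whose label is strictly smaller than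
that of every other cover $w\le y$, such that every continuation of $x\lessdot z$ inside the
interval is an ascent, while every other $w$ has some continuation $v \le y$ that is not an ascent.
By induction from the top, these greedy steps assemble into the unique increasing chain, and it is
lexicographically first (`isELLabeling_of_isGreedyStep`).

To find greedy steps, elements are described by coordinates: the color ratio $g$ of two points in a
common block (`Rel`), and the colors of the zero block. `Compat` also allows a ratio to be realized
by two zero colors, and in these terms the order is a mere implication between coordinates
(`le_iff_refines`). Hence the covers of $x$ inside $[x,y]$ can be read off from $y$: for minima
$a<b$ of blocks of $x$, a merge with ratio $\alpha$ stays below $y$ iff `y.Compat b a α`, and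
coloring the block of $a$ by $s$ stays below $y$ iff $y$ gives $a$ the color $s$. Each such cover is
the least element above $x$ with that property, and its label depends only on these data
(`IsMergeAt`, `IsColorAt`). Since $y$ is fixed along a chain, a move available at $x$ remains
available after another move unless one of its minima has been absorbed.

For $y\ne\hat1$ the greedy step is the coherent merge with the smallest label, if there is one;
otherwise the coloring with the smallest label; otherwise the non-coherent merge with the smallest
label. In $[x,\hat1]$ every merge and coloring is allowed: blocks are merged coherently until at
most one is left, which is then colored by the least color if $S\neq\emptyset$. The label $(1,2)$ of
the last edge lies above $(1,1)$ but not above $(1,k)$ for $k\ge2$, so only the least color gives an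
ascent. -/

theorem isIncreasingChain_cons_cons {P Λ : Type*} [PartialOrder Λ] {lab : P → P → Λ} {x z w : P} {t : List P} :
    IsIncreasingChain lab (x :: z :: w :: t) ↔
      lab x z < lab z w ∧ IsIncreasingChain lab (z :: w :: t) := by
  simp only [IsIncreasingChain, ← List.isChain_iff_pairwise]
  simp [chainWord]

/-! ### A local criterion for EL-labelings -/

section EL

variable {P : Type*} [PartialOrder P] {Λ : Type*} [PartialOrder Λ]

theorem IsMaximalChain.le {x y : P} {c : List P} (h : IsMaximalChain x y c) : x ≤ y := by
  induction c generalizing x with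
  | nil => exact absurd h.head (by simp)
  | cons a t ih =>
    obtain rfl : a = x := by simpa using h.head
    cases t with
    | nil => exact le_of_eq (by simpa using h.last)
    | cons b t =>
      have hc := List.isChain_cons_cons.1 h.chain
      exact hc.1.le.trans (ih ⟨rfl, by simpa using h.last, hc.2⟩)

theorem IsMaximalChain.exists_cons {x y : P} {c : List P} (h : IsMaximalChain x y c)
    (hxy : x ≠ y) : ∃ z t, c = x :: z :: t ∧ x ⋖ z ∧ IsMaximalChain z y (z :: t) := by
  rcases c with _ | ⟨a, _ | ⟨z, t⟩⟩
  · exact absurd h.head (by simp)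
  · exact absurd ((Option.some.inj h.head).symm.trans (Option.some.inj h.last)) hxy
  · obtain rfl : a = x := by simpa using h.head
    have hc := List.isChain_cons_cons.1 h.chain
    exact ⟨z, t, rfl, hc.1, rfl, by simpa using h.last, hc.2⟩

theorem IsMaximalChain.eq_singleton {x : P} {c : List P} (h : IsMaximalChain x x c) :
    c = [x] := by
  rcases c with _ | ⟨a, _ | ⟨z, t⟩⟩
  · exact absurd h.head (by simp)
  · rw [Option.some.inj h.head]
  · obtain rfl : a = x := by simpa using h.head
    have hc := List.isChain_cons_cons.1 h.chain
    have : IsMaximalChain z a (z :: t) := ⟨rfl, by simpa using h.last, hc.2⟩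
    exact absurd this.le hc.1.lt.not_ge

theorem isMaximalChain_singleton (x : P) : IsMaximalChain x x [x] :=
  ⟨rfl, rfl, List.isChain_singleton x⟩

theorem IsMaximalChain.cons {x z y : P} {t : List P} (h : x ⋖ z)
    (ht : IsMaximalChain z y (z :: t)) : IsMaximalChain x y (x :: z :: t) :=
  ⟨rfl, by simpa using ht.last, List.isChain_cons_cons.2 ⟨h, ht.chain⟩⟩

/-- `z` is the first element above `x` of the increasing maximal chain of `[x, y]`, by a condition
that only involves the labels of chains of length at most two. -/
structure IsGreedyStep (lab : P → P → Λ) (x y z : P) : Prop where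
  covBy : x ⋖ z
  le : z ≤ y
  lt : ∀ w, x ⋖ w → w ≤ y → w ≠ z → lab x z < lab x w
  descent : ∀ w, x ⋖ w → w ≤ y → w ≠ z → ∃ v, w ⋖ v ∧ v ≤ y ∧ ¬ lab x w < lab w v
  ascent : ∀ w, z ⋖ w → w ≤ y → lab x z < lab z w

/-- An increasing chain through a cover $w\ne z$ would continue with the greedy step of $[w,y]$,
whose label is the least one available at $w$. It would then be an ascent to every continuation of
$w$, against the descent condition. -/
theorem isELLabeling_of_isGreedyStep [BoundedOrder P] [WellFoundedGT P] {lab : P → P → Λ}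
    (H : ∀ x y, x < y → ∃ z, IsGreedyStep lab x y z) : IsELLabeling lab := by
  -- The induction must also remember that the increasing chain begins with a greedy step;
  -- minimality of that label is what the uniqueness argument uses.
  suffices h : ∀ y x : P, x ≤ y → ∃ c : List P, (IsMaximalChain x y c ∧ IsIncreasingChain lab c ∧
      ∀ c' : List P, IsMaximalChain x y c' → c' ≠ c → ¬ IsIncreasingChain lab c' ∧
        List.Lex (· < ·) (chainWord lab c) (chainWord lab c')) ∧
      (x < y → ∃ z t, c = x :: z :: t ∧ IsGreedyStep lab x y z) from
    fun x y hxy => (h y x hxy).imp fun c hc => hc.1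
  intro y x
  induction x using WellFoundedGT.induction with
  | ind x ih =>
    intro hxy
    rcases hxy.eq_or_lt with rfl | hlt
    · exact ⟨[x], ⟨isMaximalChain_singleton x, by simp [IsIncreasingChain, chainWord],
        fun c' hc' hne => absurd hc'.eq_singleton hne⟩, fun h => absurd h (lt_irrefl x)⟩
    obtain ⟨z, hz⟩ := H x y hlt
    obtain ⟨c, ⟨hc, hinc, hother⟩, hstart⟩ := ih z hz.covBy.lt hz.le
    obtain ⟨t, rfl⟩ : ∃ t, c = z :: t := by
      rcases c with _ | ⟨a, t⟩
      · exact absurd hc.head (by simp)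
      · exact ⟨t, by rw [Option.some.inj hc.head]⟩
    refine ⟨x :: z :: t, ⟨hc.cons hz.covBy, ?_, ?_⟩, fun _ => ⟨z, t, rfl, hz⟩⟩
    · rcases hz.le.eq_or_lt with rfl | hzy
      · rw [hc.eq_singleton]
        simp [IsIncreasingChain, chainWord]
      · obtain ⟨w, t', he, hw⟩ := hstart hzy
        rw [he] at hinc ⊢
        exact isIncreasingChain_cons_cons.2 ⟨hz.ascent w hw.covBy hw.le, hinc⟩
    · intro c' hc' hne
      obtain ⟨w, t', rfl, hxw, hw⟩ := hc'.exists_cons hlt.ne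
      by_cases hwz : w = z
      · subst hwz
        have hne' : w :: t' ≠ w :: t := fun h => hne (by rw [h])
        obtain ⟨h1, h2⟩ := hother _ hw hne'
        exact ⟨fun h => h1 (List.pairwise_cons.1 h).2, List.Lex.cons h2⟩
      · refine ⟨fun hinc' => ?_, List.Lex.rel (hz.lt w hxw hw.le hwz)⟩
        obtain ⟨d, ⟨-, -, hdother⟩, hdstart⟩ := ih w hxw.lt hw.le
        obtain ⟨v, hwv, hvy, hv⟩ := hz.descent w hxw hw.le hwz
        have hd : w :: t' = d := by
          by_contra h
          exact (hdother _ hw h).1 (List.pairwise_cons.1 hinc').2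
        obtain ⟨f, t'', he, hf⟩ := hdstart (hwv.lt.trans_le hvy)
        rw [hd, he] at hinc'
        have h1 := (isIncreasingChain_cons_cons.1 hinc').1
        by_cases hvf : v = f
        · exact hv (hvf ▸ h1)
        · exact hv (h1.trans (hf.lt v hwv hvy hvf))

end EL

/-! ### Representatives of projectivized colorings -/

namespace ProjBlock

variable {n : ℕ} {G : Type*} [Group G]

theorem exists_rep (B : ProjBlock n G) : ∃ b, mk b = B := Quotient.exists_rep B

theorem mk_eq_mk {b c : BlockColoring n G} :
    mk b = mk c ↔ ∃ g : G, ∀ i, b.1 i = (c.1 i).map (· * g) := Quotient.eq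

theorem min_mem (B : ProjBlock n G) : B.min ∈ B.carrier := Finset.min'_mem _ _

theorem min_le {B : ProjBlock n G} {i : Fin n} (h : i ∈ B.carrier) : B.min ≤ i :=
  Finset.min'_le _ _ h

theorem mem_carrier_of_eq_some {b : BlockColoring n G} {i : Fin n} {u : G}
    (h : b.1 i = some u) : i ∈ (mk b).carrier := mem_carrier_mk.2 (by simp [h])

theorem exists_eq_some {b : BlockColoring n G} {i : Fin n} (h : i ∈ (mk b).carrier) :
    ∃ u, b.1 i = some u := Option.isSome_iff_exists.1 (mem_carrier_mk.1 h)

/-- A projectivized coloring can be normalized at any element of the block. -/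
theorem exists_rep_eq_some {B : ProjBlock n G} {i : Fin n} (h : i ∈ B.carrier) (g : G) :
    ∃ b, mk b = B ∧ b.1 i = some g := by
  obtain ⟨b, rfl⟩ := B.exists_rep
  obtain ⟨u, hu⟩ := exists_eq_some h
  obtain ⟨j, hj⟩ := b.2
  exact ⟨⟨fun k => (b.1 k).map (· * (u⁻¹ * g)), j, by simpa using hj⟩, mk_eq_mk.2 ⟨_, fun _ => rfl⟩,
    by simp [hu]⟩

theorem IsUnion.exists_rep {A B C : ProjBlock n G} (h : IsUnion A B C) :
    ∃ a b c, mk a = A ∧ mk b = B ∧ mk c = C ∧ ∀ i, c.1 i = (a.1 i).or (b.1 i) := by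
  obtain ⟨a, b, c, g, ha, hb, hc, h⟩ := h
  obtain ⟨j, hj⟩ := b.2
  refine ⟨a, ⟨fun k => (b.1 k).map (· * g), j, by simpa using hj⟩, c, ha, ?_, hc, h⟩
  rw [← hb]
  exact mk_eq_mk.2 ⟨g, fun _ => rfl⟩

theorem IsUnion.min_eq {A B C : ProjBlock n G} (h : IsUnion A B C) (hlt : A.min < B.min) :
    C.min = A.min := by
  refine le_antisymm (min_le ((h.mem_carrier _).2 (Or.inl A.min_mem))) ?_
  rcases (h.mem_carrier _).1 C.min_mem with h | h
  · exact min_le h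
  · exact hlt.le.trans (min_le h)

end ProjBlock

namespace Dowling

variable {n : ℕ} {G : Type*} [Group G] {S : Type*}

/-! ### Coordinates of the Dowling poset -/

/-- `i` and `j` lie in a common block of `x`, whose coloring `b` satisfies `b i = g * b j`. -/
def Rel (x : Dowling n G S) (i j : Fin n) (g : G) : Prop :=
  ∃ b : BlockColoring n G, ProjBlock.mk b ∈ x.blocks ∧ ∃ u, b.1 j = some u ∧ b.1 i = some (g * u)

/-- The minima of the blocks. -/
noncomputable def mins (x : Dowling n G S) : Finset (Fin n) := by
  classical exact x.blocks.image ProjBlock.min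

theorem mem_mins {x : Dowling n G S} {i : Fin n} :
    i ∈ x.mins ↔ ∃ B ∈ x.blocks, B.min = i := by
  simp [mins]

theorem eq_of_mem_carrier {x : Dowling n G S} {A B : ProjBlock n G} (hA : A ∈ x.blocks)
    (hB : B ∈ x.blocks) {i : Fin n} (hiA : i ∈ A.carrier) (hiB : i ∈ B.carrier) : A = B := by
  by_contra hne
  exact Finset.disjoint_left.1 (x.disjoint A hA B hB hne) hiA hiB

/-- Equivalent colorings differ by a factor on the right, which leaves the ratio $b(i)\,b(j)^{-1}$
unchanged, so any representative may be used. -/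
theorem rel_iff {x : Dowling n G S} {b : BlockColoring n G} (hb : ProjBlock.mk b ∈ x.blocks)
    {i j : Fin n} {u g : G} (hu : b.1 j = some u) : x.Rel i j g ↔ b.1 i = some (g * u) := by
  refine ⟨?_, fun h => ⟨b, hb, u, hu, h⟩⟩
  rintro ⟨c, hc, v, hv, h⟩
  obtain ⟨k, hk⟩ := ProjBlock.mk_eq_mk.1 (eq_of_mem_carrier hb hc
    (ProjBlock.mem_carrier_of_eq_some hu) (ProjBlock.mem_carrier_of_eq_some hv))
  have h1 : u = v * k := by simpa [hu, hv] using hk j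
  rw [hk i, h, h1]
  simp [mul_assoc]

theorem zeroColor_eq_none_of_mem {x : Dowling n G S} {B : ProjBlock n G} (hB : B ∈ x.blocks)
    {i : Fin n} (hi : i ∈ B.carrier) : x.zeroColor i = none :=
  (x.zeroColor_eq_none i).2 ⟨B, hB, hi⟩

namespace Rel

variable {x : Dowling n G S} {i j k : Fin n} {g h : G}

theorem symm (H : x.Rel i j g) : x.Rel j i g⁻¹ := by
  obtain ⟨b, hb, u, hj, hi⟩ := H
  exact ⟨b, hb, g * u, hi, by simp [hj]⟩

theorem trans (H : x.Rel i j g) (H' : x.Rel j k h) : x.Rel i k (g * h) := by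
  obtain ⟨b, hb, u, hk, hj⟩ := H'
  have := (rel_iff hb hj).1 H
  exact ⟨b, hb, u, hk, by rw [this, mul_assoc]⟩

theorem unique (H : x.Rel i j g) (H' : x.Rel i j h) : g = h := by
  obtain ⟨b, hb, u, hj, hi⟩ := H
  have := (rel_iff hb hj).1 H'
  rw [hi] at this
  simpa using this

theorem zeroColor_left (H : x.Rel i j g) : x.zeroColor i = none := by
  obtain ⟨b, hb, u, hj, hi⟩ := H
  exact zeroColor_eq_none_of_mem hb (ProjBlock.mem_carrier_of_eq_some hi)

theorem zeroColor_right (H : x.Rel i j g) : x.zeroColor j = none := H.symm.zeroColor_left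

end Rel

theorem rel_self {x : Dowling n G S} {i : Fin n} (h : x.zeroColor i = none) : x.Rel i i 1 := by
  obtain ⟨B, hB, hi⟩ := (x.zeroColor_eq_none i).1 h
  obtain ⟨b, rfl, hb⟩ := ProjBlock.exists_rep_eq_some hi 1
  exact ⟨b, hB, 1, hb, by simpa using hb⟩

theorem exists_rel_of_mem {x : Dowling n G S} {B : ProjBlock n G} (hB : B ∈ x.blocks)
    {i j : Fin n} (hi : i ∈ B.carrier) (hj : j ∈ B.carrier) : ∃ g, x.Rel i j g := by
  obtain ⟨b, rfl, hb⟩ := ProjBlock.exists_rep_eq_some hj 1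
  obtain ⟨u, hu⟩ := ProjBlock.exists_eq_some hi
  exact ⟨u, b, hB, 1, hb, by simpa using hu⟩

theorem exists_rel_mins {x : Dowling n G S} {i : Fin n} (h : x.zeroColor i = none) :
    ∃ a ∈ x.mins, ∃ g, x.Rel i a g := by
  obtain ⟨B, hB, hi⟩ := (x.zeroColor_eq_none i).1 h
  exact ⟨B.min, mem_mins.2 ⟨B, hB, rfl⟩, exists_rel_of_mem hB hi B.min_mem⟩

/-- A block is recovered from the ratios of its points to one fixed point, so the ratios and the
zero colors form a complete set of coordinates. -/
theorem eq_of_rel_of_zeroColor {x y : Dowling n G S} (h : ∀ i j g, x.Rel i j g ↔ y.Rel i j g)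
    (hz : x.zeroColor = y.zeroColor) : x = y := by
  have key : ∀ x y : Dowling n G S, (∀ i j g, x.Rel i j g ↔ y.Rel i j g) →
      ∀ B ∈ x.blocks, B ∈ y.blocks := by
    intro x y h B hB
    obtain ⟨k, hk⟩ := B.carrier_nonempty
    obtain ⟨b, rfl, hb⟩ := ProjBlock.exists_rep_eq_some hk 1
    obtain ⟨c, hc, u, hu, -⟩ := (h k k 1).1
      (rel_self (zeroColor_eq_none_of_mem hB (ProjBlock.mem_carrier_of_eq_some hb)))
    convert hc using 1
    refine ProjBlock.mk_eq_mk.2 ⟨u⁻¹, fun i => Option.ext fun g => ?_⟩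
    have h1 := rel_iff hB hb (i := i) (g := g)
    have h2 := rel_iff hc hu (i := i) (g := g)
    rw [mul_one] at h1
    rw [← h1, h, h2, Option.map_eq_some_iff]
    constructor
    · intro H
      exact ⟨_, H, by simp⟩
    · rintro ⟨v, hv, rfl⟩
      simpa using hv
  exact Dowling.ext (Finset.ext fun B =>
    ⟨key x y h B, key y x (fun i j g => (h i j g).symm) B⟩) hz

section Action

variable [MulAction G S]

/-- The colors of `i` and `j` in `y` differ by `g`, either in a block or in the zero block. -/
def Compat (y : Dowling n G S) (i j : Fin n) (g : G) : Prop :=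
  y.Rel i j g ∨ ∃ s, y.zeroColor j = some s ∧ y.zeroColor i = some (g • s)

namespace Compat

variable {y : Dowling n G S} {i j k : Fin n} {g h : G} {s : S}

theorem symm (H : y.Compat i j g) : y.Compat j i g⁻¹ := by
  rcases H with H | ⟨s, h1, h2⟩
  · exact Or.inl H.symm
  · exact Or.inr ⟨g • s, h2, by simp [h1]⟩

theorem trans (H : y.Compat i j g) (H' : y.Compat j k h) : y.Compat i k (g * h) := by
  rcases H with H | ⟨s, h1, h2⟩ <;> rcases H' with H' | ⟨s', h1', h2'⟩
  · exact Or.inl (H.trans H')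
  · exact absurd H.zeroColor_right (by simp [h2'])
  · exact absurd H'.zeroColor_left (by simp [h1])
  · obtain rfl : h • s' = s := Option.some.inj (h2'.symm.trans h1)
    exact Or.inr ⟨s', h1', by rw [h2, mul_smul]⟩

theorem rel (H : y.Compat i j g) (hj : y.zeroColor j = none) : y.Rel i j g := by
  rcases H with H | ⟨s, h1, -⟩
  · exact H
  · simp [hj] at h1

theorem zeroColor (H : y.Compat i j g) (hj : y.zeroColor j = some s) :
    y.zeroColor i = some (g • s) := by
  rcases H with H | ⟨t, h1, h2⟩
  · simp [H.zeroColor_right] at hj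
  · obtain rfl : s = t := Option.some.inj (hj.symm.trans h1)
    exact h2

theorem unique (H : y.Compat i j g) (H' : y.Compat i j h) (hj : y.zeroColor j = none) : g = h :=
  (H.rel hj).unique (H'.rel hj)

end Compat

theorem compat_one_of_zeroColor {y : Dowling n G S} {i j : Fin n} {s : S}
    (hi : y.zeroColor i = some s) (hj : y.zeroColor j = some s) : y.Compat i j 1 :=
  Or.inr ⟨s, hj, by simpa using hi⟩

/-- The order of the Dowling poset in terms of coordinates, see `le_iff_refines`. -/
structure Refines (x y : Dowling n G S) : Prop where
  compat : ∀ {i j g}, x.Rel i j g → y.Compat i j g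
  zeroColor : ∀ {i s}, x.zeroColor i = some s → y.zeroColor i = some s

theorem Refines.compat_of_compat {x y : Dowling n G S} (h : Refines x y) {i j : Fin n} {g : G}
    (H : x.Compat i j g) : y.Compat i j g := by
  rcases H with H | ⟨s, h1, h2⟩
  · exact h.compat H
  · exact Or.inr ⟨s, h.zeroColor h1, h.zeroColor h2⟩

theorem Refines.rfl {x : Dowling n G S} : Refines x x := ⟨Or.inl, id⟩

theorem Refines.trans {x y z : Dowling n G S} (h : Refines x y) (h' : Refines y z) :
    Refines x z :=
  ⟨fun H => h'.compat_of_compat (h.compat H), fun H => h'.zeroColor (h.zeroColor H)⟩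

end Action

/-! ### Merging -/

namespace IsMerge

variable {x y z : Dowling n G S} {A B C : ProjBlock n G} {i j : Fin n} {g α : G}

theorem mem_blocks (h : IsMerge x z A B C) : C ∈ z.blocks := (h.blocks C).2 (Or.inl rfl)

theorem exists_rep (h : IsMerge x z A B C) : ∃ a b c, ProjBlock.mk a = A ∧ ProjBlock.mk b = B ∧
    ProjBlock.mk c = C ∧ (∀ k u, a.1 k = some u → c.1 k = some u) ∧
    ∀ k u, b.1 k = some u → c.1 k = some u := by
  obtain ⟨a, b, c, rfl, rfl, rfl, hu⟩ := h.union.exists_rep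
  refine ⟨a, b, c, rfl, rfl, rfl, fun k u hk => by simp [hu, hk], fun k u hk => ?_⟩
  have h1 := Finset.disjoint_right.1 (x.disjoint _ h.left_mem _ h.right_mem h.ne)
    (ProjBlock.mem_carrier_of_eq_some hk)
  rw [ProjBlock.mem_carrier_mk, Option.not_isSome_iff_eq_none] at h1
  simp [hu, hk, h1]

theorem rel (h : IsMerge x z A B C) (H : x.Rel i j g) : z.Rel i j g := by
  obtain ⟨d, hd, u, hj, hi⟩ := H
  obtain ⟨a, b, c, rfl, rfl, rfl, ha, hb⟩ := h.exists_rep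
  have key : ∀ e : BlockColoring n G, ProjBlock.mk e ∈ x.blocks →
      (∀ k u, e.1 k = some u → c.1 k = some u) → ProjBlock.mk d = ProjBlock.mk e →
      z.Rel i j g := by
    intro e he hec hde
    obtain ⟨v, hv⟩ := ProjBlock.exists_eq_some
      (hde ▸ ProjBlock.mem_carrier_of_eq_some hj : j ∈ (ProjBlock.mk e).carrier)
    exact (rel_iff h.mem_blocks (hec _ _ hv)).2
      (hec _ _ ((rel_iff he hv).1 ⟨d, hd, u, hj, hi⟩))
  by_cases hdA : ProjBlock.mk d = ProjBlock.mk a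
  · exact key a h.left_mem ha hdA
  by_cases hdB : ProjBlock.mk d = ProjBlock.mk b
  · exact key b h.right_mem hb hdB
  exact ⟨d, (h.blocks _).2 (Or.inr ⟨hd, hdA, hdB⟩), u, hj, hi⟩

theorem rel_min (h : IsMerge x z A B C) : ∃ g, z.Rel B.min A.min g :=
  exists_rel_of_mem h.mem_blocks ((h.union.mem_carrier _).2 (Or.inr B.min_mem))
    ((h.union.mem_carrier _).2 (Or.inl A.min_mem))

theorem mins_eq (h : IsMerge x z A B C) (hlt : A.min < B.min) : z.mins = x.mins.erase B.min := by
  ext k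
  simp only [Finset.mem_erase, mem_mins, h.blocks]
  constructor
  · rintro ⟨D, rfl | ⟨hD, hDA, hDB⟩, rfl⟩
    · rw [h.union.min_eq hlt]
      exact ⟨hlt.ne, A, h.left_mem, rfl⟩
    · exact ⟨fun he => hDB (x.min_injOn hD h.right_mem he), D, hD, rfl⟩
  · rintro ⟨hne, D, hD, rfl⟩
    by_cases hDA : D = A
    · exact ⟨C, Or.inl rfl, hDA ▸ h.union.min_eq hlt⟩
    · exact ⟨D, Or.inr ⟨hD, hDA, fun he => hne (he ▸ rfl)⟩, rfl⟩

end IsMerge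

theorem exists_isMerge_of_mem (x : Dowling n G S) {A B : ProjBlock n G} (hA : A ∈ x.blocks)
    (hB : B ∈ x.blocks) (hne : A ≠ B) {i j : Fin n} (hi : i ∈ A.carrier) (hj : j ∈ B.carrier)
    (g : G) : ∃ z C, IsMerge x z A B C ∧ z.Rel j i g := by
  classical
  obtain ⟨a, rfl, ha⟩ := ProjBlock.exists_rep_eq_some hi 1
  obtain ⟨b, rfl, hb⟩ := ProjBlock.exists_rep_eq_some hj g
  let c : BlockColoring n G := ⟨fun k => (a.1 k).or (b.1 k), i, by simp [ha]⟩
  have hu : ProjBlock.IsUnion (ProjBlock.mk a) (ProjBlock.mk b) (ProjBlock.mk c) :=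
    ⟨a, b, c, 1, rfl, rfl, rfl, fun k => by simp [c]⟩
  have hdisj : ∀ D ∈ x.blocks, D ≠ ProjBlock.mk a → D ≠ ProjBlock.mk b →
      Disjoint (ProjBlock.mk c).carrier D.carrier := fun D hD h1 h2 =>
    Finset.disjoint_left.2 fun k hk hkD => by
      rcases (hu.mem_carrier k).1 hk with hk | hk
      · exact h1 (eq_of_mem_carrier hD hA hkD hk)
      · exact h2 (eq_of_mem_carrier hD hB hkD hk)
  let z : Dowling n G S :=
    { blocks := insert (ProjBlock.mk c) ((x.blocks.erase (ProjBlock.mk a)).erase (ProjBlock.mk b))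
      zeroColor := x.zeroColor
      disjoint := by
        simp only [Finset.mem_insert, Finset.mem_erase]
        rintro D (rfl | ⟨hDB, hDA, hD⟩) E (rfl | ⟨hEB, hEA, hE⟩) hDE
        · exact absurd rfl hDE
        · exact hdisj E hE hEA hEB
        · exact (hdisj D hD hDA hDB).symm
        · exact x.disjoint D hD E hE hDE
      zeroColor_eq_none := fun k => by
        simp only [Finset.mem_insert, Finset.mem_erase, x.zeroColor_eq_none k]
        constructor
        · rintro ⟨D, hD, hk⟩
          by_cases hDA : D = ProjBlock.mk a
          · exact ⟨_, Or.inl rfl, (hu.mem_carrier k).2 (Or.inl (hDA ▸ hk))⟩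
          by_cases hDB : D = ProjBlock.mk b
          · exact ⟨_, Or.inl rfl, (hu.mem_carrier k).2 (Or.inr (hDB ▸ hk))⟩
          exact ⟨D, Or.inr ⟨hDB, hDA, hD⟩, hk⟩
        · rintro ⟨D, rfl | ⟨-, -, hD⟩, hk⟩
          · rcases (hu.mem_carrier k).1 hk with hk | hk
            · exact ⟨_, hA, hk⟩
            · exact ⟨_, hB, hk⟩
          · exact ⟨D, hD, hk⟩ }
  have hz : IsMerge x z (ProjBlock.mk a) (ProjBlock.mk b) (ProjBlock.mk c) :=
    ⟨hA, hB, hne, hu, fun D => by simp only [z, Finset.mem_insert, Finset.mem_erase]; tauto, rfl⟩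
  have hja : a.1 j = none := by
    have := Finset.disjoint_right.1 (x.disjoint _ hA _ hB hne) hj
    rwa [ProjBlock.mem_carrier_mk, Option.not_isSome_iff_eq_none] at this
  refine ⟨z, _, hz, c, hz.mem_blocks, 1, ?_, ?_⟩ <;> simp [c, ha, hb, hja]

section Action

variable [MulAction G S]

theorem IsMerge.refines {x z : Dowling n G S} {A B C : ProjBlock n G} (h : IsMerge x z A B C) :
    Refines x z :=
  ⟨fun H => Or.inl (h.rel H), fun H => by rw [h.zeroColor, H]⟩

/-- Ratios inside $C$ are generated by those inside $A$ and $B$ together with the single ratio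
$\alpha$ of the two minima, so only the latter imposes a new condition on $y$. -/
theorem IsMerge.refines_of_compat {x y z : Dowling n G S} {A B C : ProjBlock n G} {α : G}
    (h : IsMerge x z A B C) (hz : z.Rel B.min A.min α) (hxy : Refines x y)
    (hy : y.Compat B.min A.min α) : Refines z y := by
  refine ⟨fun {i j g} H => ?_, fun H => hxy.zeroColor (by rwa [← h.zeroColor])⟩
  have key : ∀ k ∈ C.carrier, ∃ u, z.Rel k A.min u ∧ y.Compat k A.min u := by
    intro k hk
    rcases (h.union.mem_carrier k).1 hk with hk | hk
    · obtain ⟨u, hu⟩ := exists_rel_of_mem h.left_mem hk A.min_mem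
      exact ⟨u, h.rel hu, hxy.compat hu⟩
    · obtain ⟨u, hu⟩ := exists_rel_of_mem h.right_mem hk B.min_mem
      exact ⟨u * α, (h.rel hu).trans hz, (hxy.compat hu).trans hy⟩
  obtain ⟨d, hd, u, hj, hi⟩ := id H
  have hj := ProjBlock.mem_carrier_of_eq_some hj
  have hi := ProjBlock.mem_carrier_of_eq_some hi
  rcases (h.blocks _).1 hd with hdC | ⟨hd, -⟩
  · obtain ⟨u, hu, hu'⟩ := key i (hdC ▸ hi)
    obtain ⟨v, hv, hv'⟩ := key j (hdC ▸ hj)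
    rw [H.unique (hu.trans hv.symm)]
    exact hu'.trans hv'.symm
  · obtain ⟨v, hv⟩ := exists_rel_of_mem hd hi hj
    rw [H.unique (h.rel hv)]
    exact hxy.compat hv

/-! ### Coloring -/

namespace IsColor

variable {x y z : Dowling n G S} {B : ProjBlock n G} {i j : Fin n} {g : G} {s : S}

theorem refines (h : IsColor x z B) : Refines x z := by
  obtain ⟨b, s, rfl, hz⟩ := h.zeroColor
  refine ⟨fun {i j g} H => ?_, fun H => by simp [hz, H]⟩
  obtain ⟨d, hd, u, hj, hi⟩ := id H
  by_cases hdB : ProjBlock.mk d = ProjBlock.mk b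
  · obtain ⟨v, hv⟩ := ProjBlock.exists_eq_some
      (hdB ▸ ProjBlock.mem_carrier_of_eq_some hj : j ∈ (ProjBlock.mk b).carrier)
    have hi := (rel_iff h.mem hv).1 H
    refine Or.inr ⟨v • s, ?_, ?_⟩
    · simp [hz, H.zeroColor_right, hv]
    · simp [hz, H.zeroColor_left, hi, mul_smul]
  · exact Or.inl ⟨d, (h.blocks _).2 ⟨hd, hdB⟩, u, hj, hi⟩

theorem exists_zeroColor (h : IsColor x z B) : ∃ s, z.zeroColor B.min = some s := by
  refine Option.ne_none_iff_exists'.1 fun hn => ?_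
  obtain ⟨D, hD, hmem⟩ := (z.zeroColor_eq_none _).1 hn
  have := (h.blocks D).1 hD
  exact this.2 (eq_of_mem_carrier this.1 h.mem hmem B.min_mem)

theorem refines_of_zeroColor (h : IsColor x z B) (hz : z.zeroColor B.min = some s)
    (hxy : Refines x y) (hy : y.zeroColor B.min = some s) : Refines z y := by
  constructor
  · rintro i j g ⟨d, hd, u, hj, hi⟩
    exact hxy.compat ⟨d, ((h.blocks _).1 hd).1, u, hj, hi⟩
  · intro i t ht
    cases hx : x.zeroColor i with
    | some t' =>
      rw [← ht, h.refines.zeroColor hx]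
      exact hxy.zeroColor hx
    | none =>
      obtain ⟨D, hD, hi⟩ := (x.zeroColor_eq_none i).1 hx
      by_cases hDB : D = B
      · subst hDB
        obtain ⟨u, hu⟩ := exists_rel_of_mem hD hi D.min_mem
        rw [← ht, (h.refines.compat hu).zeroColor hz, (hxy.compat hu).zeroColor hy]
      · have := zeroColor_eq_none_of_mem ((h.blocks D).2 ⟨hD, hDB⟩) hi
        simp [this] at ht

theorem mins_eq (h : IsColor x z B) : z.mins = x.mins.erase B.min := by
  ext k
  simp only [Finset.mem_erase, mem_mins, h.blocks]
  constructor
  · rintro ⟨D, ⟨hD, hDB⟩, rfl⟩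
    exact ⟨fun he => hDB (x.min_injOn hD h.mem he), D, hD, rfl⟩
  · rintro ⟨hne, D, hD, rfl⟩
    exact ⟨D, ⟨hD, fun he => hne (he ▸ rfl)⟩, rfl⟩

end IsColor

theorem exists_isColor_of_mem (x : Dowling n G S) {B : ProjBlock n G} (hB : B ∈ x.blocks)
    {i : Fin n} (hi : i ∈ B.carrier) (s : S) : ∃ z, IsColor x z B ∧ z.zeroColor i = some s := by
  classical
  obtain ⟨b, rfl, hb⟩ := ProjBlock.exists_rep_eq_some hi 1
  let z : Dowling n G S :=
    { blocks := x.blocks.erase (ProjBlock.mk b)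
      zeroColor := fun k => (x.zeroColor k).or ((b.1 k).map (· • s))
      disjoint := fun D hD E hE =>
        x.disjoint D (Finset.mem_of_mem_erase hD) E (Finset.mem_of_mem_erase hE)
      zeroColor_eq_none := fun k => by
        have hbk : b.1 k = none ↔ k ∉ (ProjBlock.mk b).carrier := by
          rw [ProjBlock.mem_carrier_mk, Option.not_isSome_iff_eq_none]
        simp only [Option.or_eq_none_iff, x.zeroColor_eq_none k, Option.map_eq_none_iff, hbk,
          Finset.mem_erase]
        constructor
        · rintro ⟨⟨D, hD, hk⟩, hk'⟩
          exact ⟨D, ⟨fun he => hk' (he ▸ hk), hD⟩, hk⟩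
        · rintro ⟨D, ⟨hne, hD⟩, hk⟩
          exact ⟨⟨D, hD, hk⟩, fun hk' => hne (eq_of_mem_carrier hD hB hk hk')⟩ }
  refine ⟨z, ⟨hB, fun D => ?_, b, s, rfl, fun k => rfl⟩, ?_⟩
  · simp only [z, Finset.mem_erase]
    tauto
  · simp [z, hb, zeroColor_eq_none_of_mem hB hi]

/-! ### The order in coordinates -/

theorem Step.refines {x y : Dowling n G S} (h : Step x y) : Refines x y := by
  rcases h with ⟨A, B, C, h⟩ | ⟨B, h⟩
  · exact h.refines
  · exact h.refines

/-- Every point outside the zero block of $x$ is tied to the minimum of its block. So if $y$ neither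
links two minima nor colors one, it adds nothing to $x$. -/
theorem Refines.eq {x y : Dowling n G S} (h : Refines x y)
    (hm : ∀ a ∈ x.mins, ∀ b ∈ x.mins, ∀ g, y.Compat a b g → a = b)
    (hc : ∀ a ∈ x.mins, y.zeroColor a = none) : x = y := by
  have hz : ∀ i, x.zeroColor i = none → y.zeroColor i = none := by
    intro i hi
    obtain ⟨a, ha, g, hg⟩ := exists_rel_mins hi
    by_contra hne
    obtain ⟨s, hs⟩ := Option.ne_none_iff_exists'.1 hne
    have := (h.compat hg.symm).zeroColor hs
    rw [hc a ha] at this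
    simp at this
  have hr : ∀ {i j g}, x.Rel i j g → y.Rel i j g := fun H =>
    (h.compat H).rel (hz _ H.zeroColor_right)
  have hx : ∀ {i}, y.zeroColor i = none → x.zeroColor i = none := by
    intro i hi
    by_contra hne
    obtain ⟨s, hs⟩ := Option.ne_none_iff_exists'.1 hne
    simp [h.zeroColor hs] at hi
  refine eq_of_rel_of_zeroColor (fun i j g => ⟨hr, fun H => ?_⟩) (funext fun i => ?_)
  · obtain ⟨a, ha, u, hu⟩ := exists_rel_mins (hx H.zeroColor_left)
    obtain ⟨b, hb, v, hv⟩ := exists_rel_mins (hx H.zeroColor_right)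
    obtain rfl := hm a ha b hb _ (Or.inl (((hr hu).symm.trans H).trans (hr hv)))
    have := hu.trans hv.symm
    rwa [H.unique (hr this)]
  · cases hi : x.zeroColor i with
    | none => exact (hz i hi).symm
    | some s => exact (h.zeroColor hi).symm

/-- For the converse, two linked minima or a colored minimum in $y$ dictate a step that stays below
$y$ and lowers the number of blocks; if there are none, `Refines.eq` applies. -/
theorem le_iff_refines {x y : Dowling n G S} : x ≤ y ↔ Refines x y := by
  constructor
  · intro h
    induction (h : Relation.ReflTransGen Step x y) with
    | refl => exact Refines.rfl
    | tail h1 h2 ih => exact ih.trans h2.refines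
  · intro h
    induction hk : x.blocks.card using Nat.strong_induction_on generalizing x with
    | _ k ih =>
    have key : ∀ z, Step x z → Refines z y → x ≤ y := fun z hz hzy =>
      le_trans (Relation.ReflTransGen.single hz)
        (ih _ (by have := hz.card; omega) hzy rfl)
    by_cases hm : ∀ a ∈ x.mins, ∀ b ∈ x.mins, ∀ g, y.Compat a b g → a = b
    · by_cases hc : ∀ a ∈ x.mins, y.zeroColor a = none
      · exact (h.eq hm hc).le
      · push Not at hc
        obtain ⟨a, ha, hne⟩ := hc
        obtain ⟨s, hs⟩ := Option.ne_none_iff_exists'.1 hne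
        obtain ⟨B, hB, rfl⟩ := mem_mins.1 ha
        obtain ⟨z, hz, hzs⟩ := exists_isColor_of_mem x hB B.min_mem s
        exact key z (Or.inr ⟨B, hz⟩) (hz.refines_of_zeroColor hzs h hs)
    · push Not at hm
      obtain ⟨b, hb, a, ha, g, hg, hne⟩ := hm
      obtain ⟨B, hB, rfl⟩ := mem_mins.1 hb
      obtain ⟨A, hA, rfl⟩ := mem_mins.1 ha
      obtain ⟨z, C, hz, hzs⟩ := exists_isMerge_of_mem x hA hB (fun he => hne (he ▸ rfl))
        A.min_mem B.min_mem g
      exact key z (Or.inl ⟨A, B, C, hz⟩) (hz.refines_of_compat hzs h hg)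

/-! ### Edges in coordinates -/

variable [LinearOrder S]

/-- The edge `x ⋖ z` merges the blocks with minima `a < b`, with color ratio `α`. -/
structure IsMergeAt (x z : Dowling n G S) (a b : Fin n) (α : G) : Prop where
  covBy : x ⋖ z
  lt : a < b
  left_mem : a ∈ x.mins
  right_mem : b ∈ x.mins
  rel : z.Rel b a α
  mins_eq : z.mins = x.mins.erase b
  label_coherent : α = 1 → edgeLabel x z = Label.mk 0 b ⊥
  label_nonCoherent : ∀ h : α ≠ 1, edgeLabel x z = Label.mk 2 a (WithBot.some ⟨α, h⟩)
  le_of_compat : ∀ y, x ≤ y → y.Compat b a α → z ≤ y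

/-- The edge `x ⋖ z` colors the block with minimum `a`, which gets the color `s`. -/
structure IsColorAt (x z : Dowling n G S) (a : Fin n) (s : S) : Prop where
  covBy : x ⋖ z
  mem : a ∈ x.mins
  zeroColor : z.zeroColor a = some s
  mins_eq : z.mins = x.mins.erase a
  label : edgeLabel x z = Label.mk 1 (Set.Iic s).ncard ⊥
  le_of_zeroColor : ∀ y, x ≤ y → y.zeroColor a = some s → z ≤ y

/-- With $c$ normalized to $1$ at $\min A$, the ratio $\alpha$ is the value $c(\min B)$, which turns
both label cases into a test on $\alpha$. -/
theorem IsMerge.isMergeAt {x z : Dowling n G S} {A B C : ProjBlock n G} {α : G}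
    (h : IsMerge x z A B C) (hlt : A.min < B.min) (hα : z.Rel B.min A.min α) :
    IsMergeAt x z A.min B.min α := by
  have hcov : x ⋖ z := covBy_iff_step.2 (Or.inl ⟨A, B, C, h⟩)
  obtain ⟨c, rfl, hc⟩ := ProjBlock.exists_rep_eq_some
    ((h.union.mem_carrier A.min).2 (Or.inl A.min_mem)) 1
  have hcB := (rel_iff h.mem_blocks hc).1 hα
  refine ⟨hcov, hlt, mem_mins.2 ⟨A, h.left_mem, rfl⟩, mem_mins.2 ⟨B, h.right_mem, rfl⟩, hα,
    h.mins_eq hlt, fun h1 => ?_, fun h1 => ?_, fun y hxy hy => ?_⟩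
  · rw [(hasLabel_edgeLabel hcov).unique (.coherent A B c h (by rw [hc, hcB, h1, mul_one])),
      max_eq_right hlt.le]
  · rw [(hasLabel_edgeLabel hcov).unique
      (.nonCoherent A B c h hlt 1 (α * 1) hc hcB (by simpa using h1)), h.union.min_eq hlt]
    simp
  · exact le_iff_refines.2 (h.refines_of_compat hα (le_iff_refines.1 hxy) hy)

theorem IsColor.isColorAt {x z : Dowling n G S} {B : ProjBlock n G} {s : S}
    (h : IsColor x z B) (hs : z.zeroColor B.min = some s) : IsColorAt x z B.min s := by
  have hcov : x ⋖ z := covBy_iff_step.2 (Or.inr ⟨B, h⟩)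
  exact ⟨hcov, mem_mins.2 ⟨B, h.mem, rfl⟩, hs, h.mins_eq,
    (hasLabel_edgeLabel hcov).unique (.colored B s h hs), fun y hxy hy =>
      le_iff_refines.2 (h.refines_of_zeroColor hs (le_iff_refines.1 hxy) hy)⟩

theorem exists_isMergeAt {x : Dowling n G S} {a b : Fin n} (ha : a ∈ x.mins) (hb : b ∈ x.mins)
    (hlt : a < b) (α : G) : ∃ z, IsMergeAt x z a b α := by
  obtain ⟨B, hB, rfl⟩ := mem_mins.1 hb
  obtain ⟨A, hA, rfl⟩ := mem_mins.1 ha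
  obtain ⟨z, C, hz, hα⟩ := exists_isMerge_of_mem x hA hB (fun he => hlt.ne (he ▸ rfl))
    A.min_mem B.min_mem α
  exact ⟨z, hz.isMergeAt hlt hα⟩

theorem exists_isColorAt {x : Dowling n G S} {a : Fin n} (ha : a ∈ x.mins) (s : S) :
    ∃ z, IsColorAt x z a s := by
  obtain ⟨B, hB, rfl⟩ := mem_mins.1 ha
  obtain ⟨z, hz, hs⟩ := exists_isColor_of_mem x hB B.min_mem s
  exact ⟨z, hz.isColorAt hs⟩

theorem isMergeAt_or_isColorAt {x z : Dowling n G S} (h : x ⋖ z) :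
    (∃ a b α, IsMergeAt x z a b α) ∨ ∃ a s, IsColorAt x z a s := by
  rcases covBy_iff_step.1 h with ⟨A, B, C, h⟩ | ⟨B, h⟩
  · left
    wlog hlt : A.min < B.min generalizing A B
    · exact this B A h.symm (lt_of_le_of_ne (not_lt.1 hlt) fun he =>
        h.ne (x.min_injOn h.left_mem h.right_mem he.symm))
    obtain ⟨α, hα⟩ := h.rel_min
    exact ⟨_, _, _, h.isMergeAt hlt hα⟩
  · obtain ⟨s, hs⟩ := h.exists_zeroColor
    exact Or.inr ⟨_, _, h.isColorAt hs⟩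

theorem IsMergeAt.eq {x z z' : Dowling n G S} {a b : Fin n} {α : G} (h : IsMergeAt x z a b α)
    (h' : IsMergeAt x z' a b α) : z = z' :=
  le_antisymm (h.le_of_compat z' h'.covBy.le (Or.inl h'.rel))
    (h'.le_of_compat z h.covBy.le (Or.inl h.rel))

theorem IsColorAt.eq {x z z' : Dowling n G S} {a : Fin n} {s : S} (h : IsColorAt x z a s)
    (h' : IsColorAt x z' a s) : z = z' :=
  le_antisymm (h.le_of_zeroColor z' h'.covBy.le h'.zeroColor)
    (h'.le_of_zeroColor z h.covBy.le h.zeroColor)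

theorem IsMergeAt.compat {x y z : Dowling n G S} {a b : Fin n} {α : G} (h : IsMergeAt x z a b α)
    (hy : z ≤ y) : y.Compat b a α := (le_iff_refines.1 hy).compat h.rel

theorem IsColorAt.zeroColor_of_le {x y z : Dowling n G S} {a : Fin n} {s : S}
    (h : IsColorAt x z a s) (hy : z ≤ y) : y.zeroColor a = some s :=
  (le_iff_refines.1 hy).zeroColor h.zeroColor

end Action

end Dowling

/-- Serves to move the labels to another universe. -/
theorem IsGreedyStep.comp {P Λ Λ' : Type*} [PartialOrder P] [PartialOrder Λ] [PartialOrder Λ']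
    {lab : P → P → Λ} {x y z : P} (h : IsGreedyStep lab x y z) {f : Λ → Λ'}
    (hf : ∀ a b, f a < f b ↔ a < b) : IsGreedyStep (fun u v => f (lab u v)) x y z where
  covBy := h.covBy
  le := h.le
  lt w h1 h2 h3 := (hf _ _).2 (h.lt w h1 h2 h3)
  descent w h1 h2 h3 := by simpa only [hf] using h.descent w h1 h2 h3
  ascent w h1 h2 := (hf _ _).2 (h.ascent w h1 h2)

theorem strictMono_ncard_Iic {S : Type*} [Finite S] [LinearOrder S] :
    StrictMono fun s : S => (Set.Iic s).ncard := fun _ _ h =>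
  Set.ncard_lt_ncard (Set.Iic_ssubset_Iic.2 h) (Set.toFinite _)

namespace Dowling

variable {n : ℕ} {G : Type*} [Group G] {S : Type*} [MulAction G S]

theorem Label.mk_lt_mk [LinearOrder {g : G // g ≠ 1}] {i j i' j' : ℕ}
    {α α' : WithBot {g : G // g ≠ 1}} : Label.mk i j α < Label.mk i' j' α' ↔
      i < i' ∨ i = i' ∧ (j < j' ∨ j = j' ∧ α < α') := by
  simp [Label.mk, Prod.Lex.toLex_lt_toLex]

theorem exists_covBy_of_lt {x y : Dowling n G S} (h : x < y) : ∃ z, x ⋖ z ∧ z ≤ y := by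
  rcases Relation.ReflTransGen.cases_head (show Relation.ReflTransGen Step x y from h.le) with
    h1 | ⟨w, hxw, hwy⟩
  · exact absurd h1 h.ne
  · exact ⟨w, covBy_iff_step.2 hxw, hwy⟩

instance : WellFoundedGT (Dowling n G S) :=
  StrictAnti.wellFoundedGT (f := fun x : Dowling n G S => x.blocks.card) fun _ _ h =>
    (eq_or_card_lt (show Relation.ReflTransGen Step _ _ from h.le)).resolve_left h.ne

variable [LinearOrder S]

/-! ### Greedy steps in intervals without $\hat1$ -/

section Interval

variable {x y : Dowling n G S} {a b : Fin n} {α : G} {s : S}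

theorem exists_isMergeAt_le (hxy : x ≤ y) (ha : a ∈ x.mins) (hb : b ∈ x.mins) (hlt : a < b)
    (h : y.Compat b a α) : ∃ z, IsMergeAt x z a b α ∧ z ≤ y := by
  obtain ⟨z, hz⟩ := exists_isMergeAt ha hb hlt α
  exact ⟨z, hz, hz.le_of_compat y hxy h⟩

theorem exists_isColorAt_le (hxy : x ≤ y) (ha : a ∈ x.mins) (h : y.zeroColor a = some s) :
    ∃ z, IsColorAt x z a s ∧ z ≤ y := by
  obtain ⟨z, hz⟩ := exists_isColorAt ha s
  exact ⟨z, hz, hz.le_of_zeroColor y hxy h⟩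

theorem IsMergeAt.mem_mins {z : Dowling n G S} (h : IsMergeAt x z a b α) {i : Fin n}
    (hi : i ∈ x.mins) (hne : i ≠ b) : i ∈ z.mins := by
  rw [h.mins_eq]
  exact Finset.mem_erase.2 ⟨hne, hi⟩

theorem IsColorAt.mem_mins {z : Dowling n G S} (h : IsColorAt x z a s) {i : Fin n}
    (hi : i ∈ x.mins) (hne : i ≠ a) : i ∈ z.mins := by
  rw [h.mins_eq]
  exact Finset.mem_erase.2 ⟨hne, hi⟩

theorem IsMergeAt.mem_of_mem {z : Dowling n G S} (h : IsMergeAt x z a b α) {i : Fin n}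
    (hi : i ∈ z.mins) : i ≠ b ∧ i ∈ x.mins := by
  rw [h.mins_eq] at hi
  exact Finset.mem_erase.1 hi

theorem IsColorAt.mem_of_mem {z : Dowling n G S} (h : IsColorAt x z a s) {i : Fin n}
    (hi : i ∈ z.mins) : i ≠ a ∧ i ∈ x.mins := by
  rw [h.mins_eq] at hi
  exact Finset.mem_erase.1 hi

variable [LinearOrder {g : G // g ≠ 1}]

/-- If coherent merges are possible, then the one with the smallest label is greedy. -/
theorem exists_isGreedyStep_of_coherent (hxy : x ≤ y)
    (H : ∃ b ∈ x.mins, ∃ a ∈ x.mins, a < b ∧ y.Compat b a 1) :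
    ∃ z, IsGreedyStep edgeLabel x y z := by
  classical
  obtain ⟨b, hb, hmin⟩ := Finset.exists_min_image
    (x.mins.filter fun b => ∃ a ∈ x.mins, a < b ∧ y.Compat b a 1) id
    (by obtain ⟨b, hb, H⟩ := H; exact ⟨b, Finset.mem_filter.2 ⟨hb, H⟩⟩)
  obtain ⟨hb, a, ha, hab, hc⟩ := Finset.mem_filter.1 hb
  replace hmin : ∀ b' ∈ x.mins, ∀ a' ∈ x.mins, a' < b' → y.Compat b' a' 1 → b ≤ b' :=
    fun b' hb' a' ha' hlt h => hmin b' (Finset.mem_filter.2 ⟨hb', a', ha', hlt, h⟩)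
  -- Two distinct partners of $b$ would be coherent with each other, so the larger one would be a
  -- candidate below $b$.
  have huniq : ∀ a' ∈ x.mins, a' < b → y.Compat b a' 1 → a' = a := by
    intro a' ha' hlt h
    rcases lt_trichotomy a' a with h1 | h1 | h1
    · exact absurd (hmin a ha a' ha' h1 (by simpa using hc.symm.trans h)) hab.not_ge
    · exact h1
    · exact absurd (hmin a' ha' a ha h1 (by simpa using h.symm.trans hc)) hlt.not_ge
  obtain ⟨z, hz, hzy⟩ := exists_isMergeAt_le hxy ha hb hab hc
  have hlab := hz.label_coherent rfl
  refine ⟨z, hz.covBy, hzy, fun w hxw hwy hne => ?_, fun w hxw hwy hne => ?_,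
    fun w hzw hwy => ?_⟩
  · rw [hlab]
    rcases isMergeAt_or_isColorAt hxw with ⟨a', b', β, hw⟩ | ⟨a', s, hw⟩
    · by_cases hβ : β = 1
      · subst hβ
        have hle := hmin b' hw.right_mem a' hw.left_mem hw.lt (hw.compat hwy)
        have hbb : b ≠ b' := by
          rintro rfl
          obtain rfl := huniq a' hw.left_mem hw.lt (hw.compat hwy)
          exact hne (hw.eq hz)
        simpa [hw.label_coherent rfl, Label.mk_lt_mk] using lt_of_le_of_ne hle hbb
      · simp [hw.label_nonCoherent hβ, Label.mk_lt_mk]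
    · simp [hw.label, Label.mk_lt_mk]
  · rcases isMergeAt_or_isColorAt hxw with ⟨a', b', β, hw⟩ | ⟨a', s, hw⟩
    · have hw' := hw.compat hwy
      by_cases hβ : β = 1
      · subst hβ
        have hle := hmin b' hw.right_mem a' hw.left_mem hw.lt hw'
        have hbb : b ≠ b' := by
          rintro rfl
          obtain rfl := huniq a' hw.left_mem hw.lt hw'
          exact hne (hw.eq hz)
        have hbb := lt_of_le_of_ne hle hbb
        obtain ⟨v, hv, hvy⟩ := exists_isMergeAt_le hwy (hw.mem_mins ha (hab.trans hbb).ne)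
          (hw.mem_mins hb hbb.ne) hab hc
        refine ⟨v, hv.covBy, hvy, ?_⟩
        simp only [hw.label_coherent rfl, hv.label_coherent rfl, Label.mk_lt_mk]
        simpa using hle
      · rw [hw.label_nonCoherent hβ]
        -- If $w$ has absorbed $b$ into $a'$, the link of $b$ to $a$ becomes one of $a$ to $a'$. The
        -- resulting move repeats the label, lowers the first entry to $1$ or lowers the minimum.
        by_cases hbb : b = b'
        · subst hbb
          have hca : y.Compat a a' β := by simpa using hc.symm.trans hw'
          rcases lt_trichotomy a' a with h1 | rfl | h1
          · obtain ⟨v, hv, hvy⟩ := exists_isMergeAt_le hwy (hw.mem_mins hw.left_mem hw.lt.ne)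
              (hw.mem_mins ha hab.ne) h1 hca
            exact ⟨v, hv.covBy, hvy, by simp [hv.label_nonCoherent hβ]⟩
          · cases hs : y.zeroColor a' with
            -- The same pair has both ratios $1$ and $\beta\ne1$ in $y$. This is possible only in
            -- the zero block, where stabilizers may be nontrivial, so a coloring is available.
            | none => exact absurd (hw'.unique hc hs) hβ
            | some s =>
              obtain ⟨v, hv, hvy⟩ := exists_isColorAt_le hwy (hw.mem_mins ha hab.ne) hs
              exact ⟨v, hv.covBy, hvy, by simp [hv.label, Label.mk_lt_mk]⟩
          · obtain ⟨v, hv, hvy⟩ := exists_isMergeAt_le hwy (hw.mem_mins ha hab.ne)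
              (hw.mem_mins hw.left_mem hw.lt.ne) h1 hca.symm
            refine ⟨v, hv.covBy, hvy, ?_⟩
            rw [hv.label_nonCoherent (by simpa using hβ), Label.mk_lt_mk]
            simp [h1.not_gt, Fin.val_inj, h1.ne']
        -- Here $a$ has been absorbed into $a'$; as $a$ and $b$ are coherent, merging $a'$ with $b$
        -- repeats the label of the previous edge.
        by_cases hab' : a = b'
        · subst hab'
          obtain ⟨v, hv, hvy⟩ := exists_isMergeAt_le hwy (hw.mem_mins hw.left_mem hw.lt.ne)
            (hw.mem_mins hb hbb) (hw.lt.trans hab) (by simpa using hc.trans hw' : y.Compat b a' β)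
          exact ⟨v, hv.covBy, hvy, by simp [hv.label_nonCoherent hβ]⟩
        obtain ⟨v, hv, hvy⟩ := exists_isMergeAt_le hwy (hw.mem_mins ha hab') (hw.mem_mins hb hbb)
          hab hc
        exact ⟨v, hv.covBy, hvy, by simp [hv.label_coherent rfl, Label.mk_lt_mk]⟩
    · have hw' := hw.zeroColor_of_le hwy
      rw [hw.label]
      -- Coherent minima get equal colors in $y$: once one of $a$, $b$ is colored, coloring the
      -- other repeats the label, which is not a strict ascent.
      by_cases haa : a = a'
      · subst haa
        obtain ⟨v, hv, hvy⟩ := exists_isColorAt_le hwy (hw.mem_mins hb hab.ne')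
          (by simpa using hc.zeroColor hw' : y.zeroColor b = some s)
        exact ⟨v, hv.covBy, hvy, by simp [hv.label]⟩
      by_cases hba : b = a'
      · subst hba
        obtain ⟨v, hv, hvy⟩ := exists_isColorAt_le hwy (hw.mem_mins ha hab.ne)
          (by simpa using hc.symm.zeroColor hw' : y.zeroColor a = some s)
        exact ⟨v, hv.covBy, hvy, by simp [hv.label]⟩
      obtain ⟨v, hv, hvy⟩ := exists_isMergeAt_le hwy (hw.mem_mins ha haa) (hw.mem_mins hb hba)
        hab hc
      exact ⟨v, hv.covBy, hvy, by simp [hv.label_coherent rfl, Label.mk_lt_mk]⟩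
  · rw [hlab]
    rcases isMergeAt_or_isColorAt hzw with ⟨a', b', β, hw⟩ | ⟨a', s, hw⟩
    · by_cases hβ : β = 1
      · subst hβ
        obtain ⟨hbb, hb'⟩ := hz.mem_of_mem hw.right_mem
        have hle := hmin b' hb' a' (hz.mem_of_mem hw.left_mem).2 hw.lt (hw.compat hwy)
        simpa [hw.label_coherent rfl, Label.mk_lt_mk] using lt_of_le_of_ne hle hbb.symm
      · simp [hw.label_nonCoherent hβ, Label.mk_lt_mk]
    · simp [hw.label, Label.mk_lt_mk]

/-- If no coherent merge is possible, then the coloring with the smallest label is greedy. -/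
theorem exists_isGreedyStep_of_zeroColor [Finite S] (hxy : x ≤ y)
    (hno : ∀ a ∈ x.mins, ∀ b ∈ x.mins, y.Compat a b 1 → a = b)
    (H : ∃ s, ∃ a ∈ x.mins, y.zeroColor a = some s) : ∃ z, IsGreedyStep edgeLabel x y z := by
  obtain ⟨s, ⟨a, ha, hs⟩, hmin⟩ :=
    wellFounded_lt.has_min {s : S | ∃ a ∈ x.mins, y.zeroColor a = some s} H
  -- Equal colors would permit a coherent merge, so distinct minima have distinct colors and the
  -- minimum is strict.
  replace hmin : ∀ t, ∀ a' ∈ x.mins, y.zeroColor a' = some t → a' ≠ a → s < t := by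
    intro t a' ha' ht hne
    refine lt_of_le_of_ne (not_lt.1 (hmin t ⟨a', ha', ht⟩)) ?_
    rintro rfl
    exact hne (hno a' ha' a ha (compat_one_of_zeroColor ht hs))
  obtain ⟨z, hz, hzy⟩ := exists_isColorAt_le hxy ha hs
  have hcolor : ∀ w a' t, IsColorAt x w a' t → w ≤ y → w ≠ z → a' ≠ a := by
    rintro w a' t hw hwy hne rfl
    obtain rfl := Option.some.inj ((hw.zeroColor_of_le hwy).symm.trans hs)
    exact hne (hw.eq hz)
  refine ⟨z, hz.covBy, hzy, fun w hxw hwy hne => ?_, fun w hxw hwy hne => ?_,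
    fun w hzw hwy => ?_⟩
  · rw [hz.label]
    rcases isMergeAt_or_isColorAt hxw with ⟨a', b', β, hw⟩ | ⟨a', t, hw⟩
    · by_cases hβ : β = 1
      · subst hβ
        exact absurd (hno b' hw.right_mem a' hw.left_mem (hw.compat hwy)) hw.lt.ne'
      · simp [hw.label_nonCoherent hβ, Label.mk_lt_mk]
    · have := hmin t a' hw.mem (hw.zeroColor_of_le hwy) (hcolor w a' t hw hwy hne)
      simpa [hw.label, Label.mk_lt_mk] using strictMono_ncard_Iic this
  · rcases isMergeAt_or_isColorAt hxw with ⟨a', b', β, hw⟩ | ⟨a', t, hw⟩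
    · by_cases hβ : β = 1
      · subst hβ
        exact absurd (hno b' hw.right_mem a' hw.left_mem (hw.compat hwy)) hw.lt.ne'
      -- If the merge absorbs $a$, the surviving minimum is linked to $a$ in $y$ and hence is
      -- colored there too.
      obtain ⟨d, hd, t, ht⟩ : ∃ d ∈ w.mins, ∃ t, y.zeroColor d = some t := by
        by_cases hab : a = b'
        · subst hab
          exact ⟨a', hw.mem_mins hw.left_mem hw.lt.ne, _, (hw.compat hwy).symm.zeroColor hs⟩
        · exact ⟨a, hw.mem_mins ha hab, s, hs⟩
      obtain ⟨v, hv, hvy⟩ := exists_isColorAt_le hwy hd ht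
      exact ⟨v, hv.covBy, hvy, by simp [hv.label, hw.label_nonCoherent hβ, Label.mk_lt_mk]⟩
    · have hne' := hcolor w a' t hw hwy hne
      have := hmin t a' hw.mem (hw.zeroColor_of_le hwy) hne'
      obtain ⟨v, hv, hvy⟩ := exists_isColorAt_le hwy (hw.mem_mins ha hne'.symm) hs
      refine ⟨v, hv.covBy, hvy, ?_⟩
      simpa [hv.label, hw.label, Label.mk_lt_mk] using (strictMono_ncard_Iic this).le
  · rw [hz.label]
    rcases isMergeAt_or_isColorAt hzw with ⟨a', b', β, hw⟩ | ⟨a', t, hw⟩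
    · by_cases hβ : β = 1
      · subst hβ
        exact absurd (hno b' (hz.mem_of_mem hw.right_mem).2 a' (hz.mem_of_mem hw.left_mem).2
          (hw.compat hwy)) hw.lt.ne'
      · simp [hw.label_nonCoherent hβ, Label.mk_lt_mk]
    · obtain ⟨hne, hmem⟩ := hz.mem_of_mem hw.mem
      have := hmin t a' hmem (hw.zeroColor_of_le hwy) hne
      simpa [hw.label, Label.mk_lt_mk] using strictMono_ncard_Iic this

/-- If only non-coherent merges are possible, then the one with the smallest label is greedy. -/
theorem exists_isGreedyStep_of_nonCoherent [Finite G] (hxy : x < y)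
    (hno : ∀ a ∈ x.mins, ∀ b ∈ x.mins, y.Compat a b 1 → a = b)
    (hz : ∀ a ∈ x.mins, y.zeroColor a = none) : ∃ z, IsGreedyStep edgeLabel x y z := by
  classical
  have hmerge : ∀ u w, (∀ i ∈ u.mins, i ∈ x.mins) → u ⋖ w → w ≤ y → ∃ a b β, ∃ hβ : β ≠ 1,
      IsMergeAt u w a b β ∧ edgeLabel u w = Label.mk 2 a (WithBot.some ⟨β, hβ⟩) := by
    intro u w hu huw hwy
    rcases isMergeAt_or_isColorAt huw with ⟨a', b', β, hw⟩ | ⟨a', t, hw⟩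
    · have hβ : β ≠ 1 := by
        rintro rfl
        exact hw.lt.ne' (hno _ (hu _ hw.right_mem) _ (hu _ hw.left_mem) (hw.compat hwy))
      exact ⟨a', b', β, hβ, hw, hw.label_nonCoherent hβ⟩
    · have := hw.zeroColor_of_le hwy
      rw [hz a' (hu _ hw.mem)] at this
      simp at this
  obtain ⟨w, hxw, hwy⟩ := exists_covBy_of_lt hxy
  obtain ⟨a₀, b₀, β₀, -, hw, -⟩ := hmerge x w (fun _ => id) hxw hwy
  obtain ⟨a, haT, hmin⟩ := Finset.exists_min_image
    (x.mins.filter fun a => ∃ b ∈ x.mins, a < b ∧ ∃ β, y.Compat b a β) id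
    ⟨a₀, Finset.mem_filter.2 ⟨hw.left_mem, b₀, hw.right_mem, hw.lt, β₀, hw.compat hwy⟩⟩
  obtain ⟨ha, b₁, hb₁, hlt₁, β₁, hc₁⟩ := Finset.mem_filter.1 haT
  replace hmin : ∀ a' ∈ x.mins, ∀ b' ∈ x.mins, a' < b' → ∀ β, y.Compat b' a' β → a ≤ a' :=
    fun a' ha' b' hb' hlt β h => hmin a' (Finset.mem_filter.2 ⟨ha', b', hb', hlt, β, h⟩)
  have hβ₁ : β₁ ≠ 1 := by
    rintro rfl
    exact hlt₁.ne' (hno _ hb₁ _ ha hc₁)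
  obtain ⟨⟨α, hα⟩, ⟨b, hb, hab, hc⟩, hαmin⟩ := (wellFounded_lt (α := {g : G // g ≠ 1})).has_min
    {β | ∃ b ∈ x.mins, a < b ∧ y.Compat b a β.1} ⟨⟨β₁, hβ₁⟩, b₁, hb₁, hlt₁, hc₁⟩
  obtain ⟨z, hzx, hzy⟩ := exists_isMergeAt_le hxy.le ha hb hab hc
  have hlab := hzx.label_nonCoherent hα
  -- For fixed $a$ the ratio determines the partner: two partners with the same ratio would be
  -- coherent with each other. So the smallest label is attained by one pair only.
  have hlt : ∀ a' ∈ x.mins, ∀ b' ∈ x.mins, a' < b' → ∀ β (hβ : β ≠ 1), y.Compat b' a' β →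
      ¬ (a' = a ∧ b' = b) → a < a' ∨ a' = a ∧ b' ≠ b ∧ (⟨α, hα⟩ : {g : G // g ≠ 1}) < ⟨β, hβ⟩ := by
    intro a' ha' b' hb' hlt β hβ h hne
    rcases (hmin a' ha' b' hb' hlt β h).lt_or_eq with h1 | rfl
    · exact Or.inl h1
    · have hbb : b' ≠ b := fun h => hne ⟨rfl, h⟩
      refine Or.inr ⟨rfl, hbb, lt_of_le_of_ne (not_lt.1 (hαmin ⟨β, hβ⟩ ⟨b', hb', hlt, h⟩)) ?_⟩
      intro he
      obtain rfl : α = β := congrArg Subtype.val he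
      exact hbb (hno b' hb' b hb (by simpa using h.trans hc.symm))
  -- As $a$ lies in a block of $y$, not in the zero block, the pair has only one ratio.
  have hnot : ∀ w a' b' β, IsMergeAt x w a' b' β → w ≤ y → w ≠ z → ¬ (a' = a ∧ b' = b) := by
    rintro w _ _ β hw hwy hne ⟨rfl, rfl⟩
    obtain rfl := (hw.compat hwy).unique hc (hz _ ha)
    exact hne (hw.eq hzx)
  refine ⟨z, hzx.covBy, hzy, fun w hxw hwy hne => ?_, fun w hxw hwy hne => ?_,
    fun w hzw hwy => ?_⟩
  · obtain ⟨a', b', β, hβ, hw, hwl⟩ := hmerge x w (fun _ => id) hxw hwy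
    rw [hlab, hwl, Label.mk_lt_mk]
    rcases hlt a' hw.left_mem b' hw.right_mem hw.lt β hβ (hw.compat hwy)
      (hnot w a' b' β hw hwy hne) with h | ⟨rfl, -, h⟩
    · simp [h]
    · simp [h]
  · obtain ⟨a', b', β, hβ, hw, hwl⟩ := hmerge x w (fun _ => id) hxw hwy
    rw [hwl]
    have hw' := hw.compat hwy
    rcases hlt a' hw.left_mem b' hw.right_mem hw.lt β hβ hw'
      (hnot w a' b' β hw hwy hne) with h | ⟨rfl, hbb, h⟩
    -- The block of $a$ still has a partner in $w$, namely $b$, or $a'$ if $b$ was absorbed into it.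
    -- Any merge with it has a label below that of $w$, whatever the ratio.
    · obtain ⟨d, hd, had, γ, hγ⟩ : ∃ d ∈ w.mins, a < d ∧ ∃ γ, y.Compat d a γ := by
        by_cases hbb : b = b'
        · subst hbb
          exact ⟨a', hw.mem_mins hw.left_mem hw.lt.ne, h, _, hw'.symm.trans hc⟩
        · exact ⟨b, hw.mem_mins hb hbb, hab, α, hc⟩
      obtain ⟨v, hv, hvy⟩ := exists_isMergeAt_le hwy (hw.mem_mins ha (h.trans hw.lt).ne) hd had hγ
      refine ⟨v, hv.covBy, hvy, ?_⟩
      by_cases h1 : γ = 1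
      · simp [hv.label_coherent h1, Label.mk_lt_mk]
      · simp [hv.label_nonCoherent h1, Label.mk_lt_mk, h.not_gt, Fin.val_inj, h.ne']
    · obtain ⟨v, hv, hvy⟩ := exists_isMergeAt_le hwy (hw.mem_mins ha hw.lt.ne)
        (hw.mem_mins hb hbb.symm) hab hc
      refine ⟨v, hv.covBy, hvy, ?_⟩
      rw [hv.label_nonCoherent hα, Label.mk_lt_mk]
      simpa using h.le
  · obtain ⟨a', b', β, hβ, hw, hwl⟩ := hmerge z w (fun i hi => (hzx.mem_of_mem hi).2) hzw hwy
    obtain ⟨hne, hmem⟩ := hzx.mem_of_mem hw.right_mem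
    rw [hlab, hwl, Label.mk_lt_mk]
    rcases hlt a' (hzx.mem_of_mem hw.left_mem).2 b' hmem hw.lt β hβ (hw.compat hwy)
      (fun h => hne h.2) with h | ⟨rfl, -, h⟩
    · simp [h]
    · simp [h]

theorem exists_isGreedyStep [Finite G] [Finite S] (hxy : x < y) :
    ∃ z, IsGreedyStep edgeLabel x y z := by
  by_cases hno : ∀ a ∈ x.mins, ∀ b ∈ x.mins, y.Compat a b 1 → a = b
  · by_cases hz : ∀ a ∈ x.mins, y.zeroColor a = none
    · exact exists_isGreedyStep_of_nonCoherent hxy hno hz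
    · push Not at hz
      obtain ⟨a, ha, hne⟩ := hz
      obtain ⟨s, hs⟩ := Option.ne_none_iff_exists'.1 hne
      exact exists_isGreedyStep_of_zeroColor hxy.le hno ⟨s, a, ha, hs⟩
  · push Not at hno
    obtain ⟨a, ha, b, hb, h, hne⟩ := hno
    refine exists_isGreedyStep_of_coherent hxy.le ?_
    rcases hne.lt_or_gt with hlt | hlt
    · exact ⟨b, hb, a, ha, hlt, by simpa using h.symm⟩
    · exact ⟨a, ha, b, hb, hlt, h⟩

end Interval

/-! ### Intervals with top element `⊤` -/

theorem isMax_of_mins_eq_empty {x : Dowling n G S} (h : x.mins = ∅) : IsMax x := by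
  refine isMax_iff_forall_not_lt.2 fun y hy => ?_
  obtain ⟨z, hz, -⟩ := exists_covBy_of_lt hy
  rcases isMergeAt_or_isColorAt hz with ⟨a, b, α, hw⟩ | ⟨a, s, hw⟩
  · simpa [h] using hw.left_mem
  · simpa [h] using hw.mem

theorem exists_isColorAt_of_not_isMax {x : Dowling n G S} (hx : ¬ IsMax x)
    (h : ∀ a ∈ x.mins, ∀ b ∈ x.mins, a = b) : ∃ z a s, IsColorAt x z a s := by
  obtain ⟨y, hy⟩ := not_isMax_iff.1 hx
  obtain ⟨z, hz, -⟩ := exists_covBy_of_lt hy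
  rcases isMergeAt_or_isColorAt hz with ⟨a, b, α, hw⟩ | ⟨a, s, hw⟩
  · exact absurd (h a hw.left_mem b hw.right_mem) hw.lt.ne
  · exact ⟨z, a, s, hw⟩

section Top

variable [LinearOrder {g : G // g ≠ 1}] {x : Dowling n G S}

theorem isGreedyStep_coe {y z : Dowling n G S}
    (h : IsGreedyStep edgeLabel x y z) :
    IsGreedyStep label (x : WithTop (Dowling n G S)) y z where
  covBy := WithTop.coe_covBy_coe.2 h.covBy
  le := WithTop.coe_le_coe.2 h.le
  lt w hxw hwy hne := by
    obtain ⟨w, rfl, -⟩ := WithTop.le_coe_iff.1 hwy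
    exact h.lt w (WithTop.coe_covBy_coe.1 hxw) (WithTop.coe_le_coe.1 hwy) fun he => hne (he ▸ rfl)
  descent w hxw hwy hne := by
    obtain ⟨w, rfl, -⟩ := WithTop.le_coe_iff.1 hwy
    obtain ⟨v, h1, h2, h3⟩ := h.descent w (WithTop.coe_covBy_coe.1 hxw)
      (WithTop.coe_le_coe.1 hwy) fun he => hne (he ▸ rfl)
    exact ⟨v, WithTop.coe_covBy_coe.2 h1, WithTop.coe_le_coe.2 h2, h3⟩
  ascent w hzw hwy := by
    obtain ⟨w, rfl, -⟩ := WithTop.le_coe_iff.1 hwy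
    exact h.ascent w (WithTop.coe_covBy_coe.1 hzw) (WithTop.coe_le_coe.1 hwy)

/-- Provides the descent after a non-coherent merge: below $\hat1$ there is always a coherent merge,
a coloring or the final edge to continue with. -/
theorem exists_covBy_label_lt_two (x : Dowling n G S) : ∃ v : WithTop (Dowling n G S),
    (x : WithTop (Dowling n G S)) ⋖ v ∧ ∀ j α, label (x : WithTop (Dowling n G S)) v <
      Label.mk 2 j α := by
  by_cases h : ∀ a ∈ x.mins, ∀ b ∈ x.mins, a = b
  · by_cases hx : IsMax x
    · exact ⟨⊤, WithTop.coe_covBy_top.2 hx, fun j α => Label.mk_lt_mk.2 (by simp)⟩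
    · obtain ⟨z, a, s, hz⟩ := exists_isColorAt_of_not_isMax hx h
      exact ⟨z, WithTop.coe_covBy_coe.2 hz.covBy, fun j α => by
        simp [label, hz.label, Label.mk_lt_mk]⟩
  · push Not at h
    obtain ⟨a, ha, b, hb, hne⟩ := h
    wlog hlt : a < b generalizing a b
    · exact this b hb a ha hne.symm (lt_of_le_of_ne (not_lt.1 hlt) hne.symm)
    obtain ⟨z, hz⟩ := exists_isMergeAt ha hb hlt 1
    exact ⟨z, WithTop.coe_covBy_coe.2 hz.covBy, fun j α => by
      simp [label, hz.label_coherent rfl, Label.mk_lt_mk]⟩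

theorem exists_isGreedyStep_top_of_lt (H : ∃ b ∈ x.mins, ∃ a ∈ x.mins, a < b) :
    ∃ z, IsGreedyStep label (x : WithTop (Dowling n G S)) ⊤ z := by
  classical
  obtain ⟨b, hb, hmin⟩ := Finset.exists_min_image
    (x.mins.filter fun b => ∃ a ∈ x.mins, a < b) id
    (by obtain ⟨b, hb, H⟩ := H; exact ⟨b, Finset.mem_filter.2 ⟨hb, H⟩⟩)
  obtain ⟨hb, a, ha, hab⟩ := Finset.mem_filter.1 hb
  replace hmin : ∀ b' ∈ x.mins, ∀ a' ∈ x.mins, a' < b' → b ≤ b' :=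
    fun b' hb' a' ha' hlt => hmin b' (Finset.mem_filter.2 ⟨hb', a', ha', hlt⟩)
  obtain ⟨z, hz⟩ := exists_isMergeAt ha hb hab 1
  have hlab : label (x : WithTop (Dowling n G S)) z = Label.mk 0 b ⊥ := hz.label_coherent rfl
  have hnotMax : ¬ IsMax x := fun h => h.not_lt hz.covBy.lt
  have hcoh : ∀ w a' b', IsMergeAt x w a' b' 1 → w ≠ z → b < b' := by
    intro w a' b' hw hne
    refine lt_of_le_of_ne (hmin b' hw.right_mem a' hw.left_mem hw.lt) ?_
    rintro rfl
    have : a' = a := by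
      rcases lt_trichotomy a' a with h1 | h1 | h1
      · exact absurd (hmin a ha a' hw.left_mem h1) hab.not_ge
      · exact h1
      · exact absurd (hmin a' hw.left_mem a ha h1) hw.lt.not_ge
    subst this
    exact hne (hw.eq hz)
  refine ⟨z, WithTop.coe_covBy_coe.2 hz.covBy, le_top, fun w hxw _ hne => ?_,
    fun w hxw _ hne => ?_, fun w hzw _ => ?_⟩
  · rw [hlab]
    induction w with
    | top => exact absurd (WithTop.coe_covBy_top.1 hxw) hnotMax
    | coe w =>
      have hne : w ≠ z := fun h => hne (h ▸ rfl)
      rcases isMergeAt_or_isColorAt (WithTop.coe_covBy_coe.1 hxw) with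
        ⟨a', b', β, hw⟩ | ⟨a', t, hw⟩
      · by_cases hβ : β = 1
        · subst hβ
          simpa [label, hw.label_coherent rfl, Label.mk_lt_mk] using hcoh w a' b' hw hne
        · simp [label, hw.label_nonCoherent hβ, Label.mk_lt_mk]
      · simp [label, hw.label, Label.mk_lt_mk]
  · induction w with
    | top => exact absurd (WithTop.coe_covBy_top.1 hxw) hnotMax
    | coe w =>
      have hne : w ≠ z := fun h => hne (h ▸ rfl)
      rcases isMergeAt_or_isColorAt (WithTop.coe_covBy_coe.1 hxw) with
        ⟨a', b', β, hw⟩ | ⟨a', t, hw⟩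
      · by_cases hβ : β = 1
        · subst hβ
          have hbb := hcoh w a' b' hw hne
          obtain ⟨v, hv⟩ := exists_isMergeAt (hw.mem_mins ha (hab.trans hbb).ne)
            (hw.mem_mins hb hbb.ne) hab 1
          refine ⟨v, WithTop.coe_covBy_coe.2 hv.covBy, le_top, ?_⟩
          simpa [label, hw.label_coherent rfl, hv.label_coherent rfl, Label.mk_lt_mk] using hbb.le
        · obtain ⟨v, hv, hlt⟩ := exists_covBy_label_lt_two w
          refine ⟨v, hv, le_top, ?_⟩
          have : label (x : WithTop (Dowling n G S)) w = _ := hw.label_nonCoherent hβ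
          rw [this]
          exact (hlt _ _).not_gt
      · obtain ⟨d, hd⟩ : ∃ d, d ∈ w.mins := by
          by_cases haa : a = a'
          · exact ⟨b, hw.mem_mins hb (haa ▸ hab.ne')⟩
          · exact ⟨a, hw.mem_mins ha haa⟩
        -- A second block may be given the same color $t$, which repeats the label.
        obtain ⟨v, hv⟩ := exists_isColorAt hd t
        exact ⟨v, WithTop.coe_covBy_coe.2 hv.covBy, le_top, by simp [label, hw.label, hv.label]⟩
  · rw [hlab]
    induction w with
    | top => exact Label.mk_lt_mk.2 (by simp)
    | coe w =>
      rcases isMergeAt_or_isColorAt (WithTop.coe_covBy_coe.1 hzw) with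
        ⟨a', b', β, hw⟩ | ⟨a', t, hw⟩
      · by_cases hβ : β = 1
        · subst hβ
          obtain ⟨hbb, hb'⟩ := hz.mem_of_mem hw.right_mem
          have hle := hmin b' hb' a' (hz.mem_of_mem hw.left_mem).2 hw.lt
          simpa [label, hw.label_coherent rfl, Label.mk_lt_mk] using lt_of_le_of_ne hle hbb.symm
        · simp [label, hw.label_nonCoherent hβ, Label.mk_lt_mk]
      · simp [label, hw.label, Label.mk_lt_mk]

theorem exists_isGreedyStep_top_of_isMax (hx : IsMax x) :
    ∃ z, IsGreedyStep label (x : WithTop (Dowling n G S)) ⊤ z := by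
  have huniq : ∀ w : WithTop (Dowling n G S), (x : WithTop (Dowling n G S)) ⋖ w → w = ⊤ := by
    intro w hw
    induction w with
    | top => rfl
    | coe w => exact absurd (WithTop.coe_covBy_coe.1 hw).lt hx.not_lt
  exact ⟨⊤, WithTop.coe_covBy_top.2 hx, le_rfl, fun w hw _ hne => absurd (huniq w hw) hne,
    fun w hw _ hne => absurd (huniq w hw) hne, fun w hw _ => absurd hw.lt not_top_lt⟩

/-- With a single block left, the only chains are one coloring followed by the final edge, with
words $(1,k)(1,2)$; only $k=1$ is increasing. -/
theorem exists_isGreedyStep_top_of_not_isMax [Finite S] (hx : ¬ IsMax x)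
    (h : ∀ a ∈ x.mins, ∀ b ∈ x.mins, a = b) :
    ∃ z, IsGreedyStep label (x : WithTop (Dowling n G S)) ⊤ z := by
  obtain ⟨z₀, a, s₀, hc⟩ := exists_isColorAt_of_not_isMax hx h
  have ha := hc.mem
  have : Nonempty S := ⟨s₀⟩
  obtain ⟨s, hs⟩ := Finite.exists_min (id : S → S)
  have hs1 : (Set.Iic s).ncard = 1 := by
    rw [Set.ncard_eq_one]
    exact ⟨s, Set.ext fun t => ⟨fun ht => le_antisymm ht (hs t), fun ht => le_of_eq ht⟩⟩
  obtain ⟨z, hz⟩ := exists_isColorAt ha s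
  have hcover : ∀ w : WithTop (Dowling n G S), (x : WithTop (Dowling n G S)) ⋖ w →
      ∃ (w' : Dowling n G S) (t : S), w = (w' : WithTop (Dowling n G S)) ∧ IsColorAt x w' a t := by
    intro w hw
    induction w with
    | top => exact absurd (WithTop.coe_covBy_top.1 hw) hx
    | coe w =>
      rcases isMergeAt_or_isColorAt (WithTop.coe_covBy_coe.1 hw) with
        ⟨a', b', β, hw⟩ | ⟨a', t, hw⟩
      · exact absurd (h _ hw.left_mem _ hw.right_mem) hw.lt.ne
      · obtain rfl := h _ hw.mem _ ha
        exact ⟨w, t, rfl, hw⟩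
  have hmax : ∀ w t, IsColorAt x w a t → IsMax w := fun w t hw =>
    isMax_of_mins_eq_empty (Finset.eq_empty_of_forall_notMem fun i hi =>
      (hw.mem_of_mem hi).1 (h _ (hw.mem_of_mem hi).2 _ ha))
  have hlt : ∀ w t, IsColorAt x w a t → (w : WithTop (Dowling n G S)) ≠ z →
      1 < (Set.Iic t).ncard := by
    intro w t hw hne
    rw [← hs1]
    refine strictMono_ncard_Iic (lt_of_le_of_ne (hs t) ?_)
    rintro rfl
    exact hne (by rw [hw.eq hz])
  have hlab : label (x : WithTop (Dowling n G S)) z = Label.mk 1 1 ⊥ :=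
    hz.label.trans (by rw [hs1])
  refine ⟨z, WithTop.coe_covBy_coe.2 hz.covBy, le_top, fun w hxw _ hne => ?_,
    fun w hxw _ hne => ?_, fun w hzw _ => ?_⟩
  · obtain ⟨w, t, rfl, hw⟩ := hcover w hxw
    rw [hlab]
    simpa [label, hw.label, Label.mk_lt_mk] using hlt w t hw hne
  · obtain ⟨w, t, rfl, hw⟩ := hcover w hxw
    refine ⟨⊤, WithTop.coe_covBy_top.2 (hmax w t hw), le_rfl, ?_⟩
    have h1 : label (x : WithTop (Dowling n G S)) w = _ := hw.label
    have h2 : label (w : WithTop (Dowling n G S)) ⊤ = Label.mk 1 2 ⊥ := rfl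
    have := hlt w t hw hne
    rw [h1, h2, Label.mk_lt_mk]
    simp only [lt_irrefl, and_false, or_false, true_and, false_or]
    omega
  · rw [hlab]
    induction w with
    | top => exact Label.mk_lt_mk.2 (by simp)
    | coe w => exact absurd (WithTop.coe_covBy_coe.1 hzw).lt (hmax z s hz).not_lt

theorem exists_isGreedyStep_label [Finite G] [Finite S] {x y : WithTop (Dowling n G S)}
    (hxy : x < y) : ∃ z, IsGreedyStep label x y z := by
  obtain ⟨x, rfl⟩ := WithTop.ne_top_iff_exists.1 hxy.ne_top
  induction y with
  | coe y =>
    obtain ⟨z, hz⟩ := exists_isGreedyStep (WithTop.coe_lt_coe.1 hxy)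
    exact ⟨z, isGreedyStep_coe hz⟩
  | top =>
    by_cases h : ∀ a ∈ x.mins, ∀ b ∈ x.mins, a = b
    · by_cases hx : IsMax x
      · exact exists_isGreedyStep_top_of_isMax hx
      · exact exists_isGreedyStep_top_of_not_isMax hx h
    · push Not at h
      obtain ⟨a, ha, b, hb, hne⟩ := h
      refine exists_isGreedyStep_top_of_lt ?_
      rcases hne.lt_or_gt with hlt | hlt
      · exact ⟨b, hb, a, ha, hlt⟩
      · exact ⟨a, ha, b, hb, hlt⟩

end Top

end Dowling

theorem theoremA (n : ℕ) (G : Type*) [Group G] [Finite G] (S : Type*) [Finite S] [MulAction G S] :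
    (∀ [LinearOrder S] [LinearOrder {g : G // g ≠ 1}],
      IsELLabeling (Dowling.label : WithTop (Dowling n G S) → WithTop (Dowling n G S) →
        Dowling.Label G)) ∧
    IsELShellable (WithTop (Dowling n G S)) := by
  refine ⟨isELLabeling_of_isGreedyStep fun x y => Dowling.exists_isGreedyStep_label, ?_⟩
  let _ : LinearOrder S := IsWellOrder.linearOrder WellOrderingRel
  let _ : LinearOrder {g : G // g ≠ 1} := IsWellOrder.linearOrder WellOrderingRel
  -- The labels live in the universe of $G$ alone, whereas `IsELShellable` asks for that of the
  -- poset, which also involves $S$.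
  refine ⟨ULift (Dowling.Label G), inferInstance, fun x y => ULift.up (Dowling.label x y),
    isELLabeling_of_isGreedyStep fun x y hxy => ?_⟩
  obtain ⟨z, hz⟩ := Dowling.exists_isGreedyStep_label hxy
  exact ⟨z, hz.comp fun a b => ULift.up_lt⟩
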